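/- Let $\mathcal Z=\{0,1,2,\dots\}$, let $\mathcal M_1(\mathcal Z)$ be the space of probability measures on $\mathcal Z$ with the total variation metric (equivalently, with the topology of weak convergence), and for $N\ge 1$ let $\mathcal M_1^N(\mathcal Z)\subset\mathcal M_1(\mathcal Z)$ be the set of empirical measures $\frac1N\sum_{i=1}^N\delta_{x_i}$ of configurations $x\in\mathcal Z^N$. Let $(\mathcal Z,\mathcal E)$ be a directed graph, let $\lambda_{z,z'}:\mathcal M_1(\mathcal Z)\to\mathbb R_+$, $(z,z')\in\mathcal E$, be transition rates, and let $$\mathscr L^N f(\xi)=\sum_{(z,z')\in\mathcal E}N\xi(z)\,\lambda_{z,z'}(\xi)\Big[f\Big(\xi+\frac{\delta_{z'}}N-\frac{\delta_z}N\Big)-f(\xi)\Big],\qquad \xi\in\mathcal M_1^N(\mathcal Z),$$ for bounded functions $f$ on $\mathcal M_1^N(\mathcal Z)$. Assume (A1) $\mathcal E=\{(z,z+1):z\in\mathcal Z\}\cup\{(z,0):z\in\mathcal Z\setminus\{0\}\}$; (A2) there are constants $\underline\lambda,\overline\lambda>0$ such that, for every $\xi\in\mathcal M_1(\mathcal Z)$,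 $\frac{\underline\lambda}{z+1}\le\lambda_{z,z+1}(\xi)\le\frac{\overline\lambda}{z+1}$ for all $z\in\mathcal Z$, and $\underline\lambda\le\lambda_{z,0}(\xi)\le\overline\lambda$ for all $z\in\mathcal Z\setminus\{0\}$. Then for each $N\ge1$ there is exactly one Markov transition semigroup on $\mathcal M_1^N(\mathcal Z)$ with infinitesimal generator $\mathscr L^N$ (in the sense that $(P_tf-f)/t\to\mathscr L^Nf$ uniformly as $t\downarrow0$ for every bounded $f$), and it has a unique invariant probability measure $\wp^N$. The family $\{\wp^N,N\ge1\}$ is exponentially tight in $\mathcal M_1(\mathcal Z)$: for every $M>0$ there is a compact set $K\subset\mathcal M_1(\mathcal Z)$ with $\limsup_{N\to\infty}\frac1N\log\wp^N(\mathcal M_1(\mathcal Z)\setminus K)\le -M$. More precisely, there is $\beta>0$, depending only on $\underline\lambda$ and $\overline\lambda$, such that for all $N\ge1$ and $M>0$ $$\wp^N\big(\mathcal M_1(\mathcal Z)\setminus\mathscr K_M\big)\le\exp\{-N(M\beta-1)\},\qquad \mathscr K_M=\Big\{\xi\in\mathcal M_1(\mathcal Z):\sum_{z\in\mathcal Z}\xi(z)\,z\log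 z\le M\Big\},$$ where $0\log0=0$. -/

import Mathlib

open MeasureTheory ProbabilityTheory Filter Topology
open scoped NNReal ENNReal

noncomputable section

namespace MeanField

/-- The space of probability measures on the nonnegative integers, with the topology of weak
convergence (on a countable discrete space this is also the topology of the total variation
metric). -/
abbrev M1 : Type := ProbabilityMeasure ℕ

/-- The set of probability measures on `ℕ` that arise as empirical measures
`(1/N) ∑ i, δ_{x i}` of `N`-particle configurations `x`. -/
def empiricalSet (N : ℕ) : Set M1 :=
  {ξ | ∃ x : Fin N → ℕ, (ξ : Measure ℕ) = (N : ℝ≥0∞)⁻¹ • ∑ i, Measure.dirac (x i)}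

/-- The state space of the `N`-particle empirical measure process. -/
abbrev M1N (N : ℕ) : Type := empiricalSet N

/-- The configuration `ξ + δ_{z'}/N - δ_z/N`, i.e. the (unique) `η` with
`η + δ_z/N = ξ + δ_{z'}/N`. It exists whenever `ξ {z} > 0`; otherwise the value is irrelevant
and set to `ξ`. -/
def jump (N : ℕ) (ξ : M1N N) (z z' : ℕ) : M1N N :=
  open Classical in
  if h : ∃ η : M1N N, ((η : M1) : Measure ℕ) + (N : ℝ≥0∞)⁻¹ • Measure.dirac z
      = ((ξ : M1) : Measure ℕ) + (N : ℝ≥0∞)⁻¹ • Measure.dirac z'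
  then h.choose else ξ

/-- If particle `i` of the configuration `x` sits at `z`, the jump from `z` to `z'` leads to the
empirical measure of the configuration in which particle `i` has been moved to `z'`. -/
theorem jump_eq {N : ℕ} {ξ : M1N N} {x : Fin N → ℕ}
    (hx : ((ξ : M1) : Measure ℕ) = (N : ℝ≥0∞)⁻¹ • ∑ i, Measure.dirac (x i)) (i : Fin N) (z' : ℕ) :
    ((jump N ξ (x i) z' : M1) : Measure ℕ)
      = (N : ℝ≥0∞)⁻¹ • ∑ j, Measure.dirac (Function.update x i z' j) := by
  classical
  have hN : (N : ℝ≥0∞) ≠ 0 := by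
    have := i.pos
    exact_mod_cast this.ne'
  have hN' : (N : ℝ≥0∞) ≠ ⊤ := ENNReal.natCast_ne_top N
  have key : (∑ j, Measure.dirac (Function.update x i z' j)) + Measure.dirac (x i)
      = (∑ j, Measure.dirac (x j)) + Measure.dirac z' := by
    rw [← Finset.add_sum_erase _ _ (Finset.mem_univ i),
      ← Finset.add_sum_erase _ (fun j => Measure.dirac (x j)) (Finset.mem_univ i)]
    have : ∑ j ∈ Finset.univ.erase i, Measure.dirac (Function.update x i z' j)
        = ∑ j ∈ Finset.univ.erase i, Measure.dirac (x j) :=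
      Finset.sum_congr rfl fun j hj => by
        rw [Function.update_of_ne (Finset.ne_of_mem_erase hj)]
    rw [this, Function.update_self]
    abel
  have key' : (N : ℝ≥0∞)⁻¹ • (∑ j, Measure.dirac (Function.update x i z' j))
        + (N : ℝ≥0∞)⁻¹ • Measure.dirac (x i)
      = ((ξ : M1) : Measure ℕ) + (N : ℝ≥0∞)⁻¹ • Measure.dirac z' := by
    rw [hx, ← smul_add, ← smul_add, key]
  have hp : IsProbabilityMeasure
      ((N : ℝ≥0∞)⁻¹ • ∑ j, Measure.dirac (Function.update x i z' j)) := by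
    constructor
    simp [ENNReal.inv_mul_cancel hN hN']
  have h : ∃ η : M1N N, ((η : M1) : Measure ℕ) + (N : ℝ≥0∞)⁻¹ • Measure.dirac (x i)
      = ((ξ : M1) : Measure ℕ) + (N : ℝ≥0∞)⁻¹ • Measure.dirac z' :=
    ⟨⟨⟨_, hp⟩, Function.update x i z', rfl⟩, key'⟩
  have hs := h.choose_spec.trans key'.symm
  rw [jump, dif_pos h]
  ext s hs'
  have h1 := congrArg (fun m : Measure ℕ => m s) hs
  simp only [Measure.add_apply] at h1
  refine (ENNReal.add_left_inj ?_).1 h1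
  rw [Measure.smul_apply, smul_eq_mul]
  exact ENNReal.mul_ne_top (ENNReal.inv_ne_top.2 hN) (measure_ne_top _ _)

/-- The generator of the `N`-particle empirical measure process on the directed graph with edge
set `E` and transition rates `lam z z' ξ`, `(z, z') ∈ E`:
`f ↦ ∑_{(z,z') ∈ E} N ξ(z) λ_{z,z'}(ξ) (f(ξ + δ_{z'}/N - δ_z/N) - f(ξ))`. -/
def generator (E : Set (ℕ × ℕ)) (lam : ℕ → ℕ → M1 → ℝ) (N : ℕ)
    (f : M1N N → ℝ) (ξ : M1N N) : ℝ :=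
  ∑' e : E, (N : ℝ) * ((ξ : M1) : Measure ℕ).real {e.1.1} * lam e.1.1 e.1.2 (ξ : M1)
    * (f (jump N ξ e.1.1 e.1.2) - f ξ)

/-- `P` is the transition semigroup of a (time-homogeneous, conservative) Markov process on `S`
with infinitesimal generator `L`: Markov kernels with the Chapman-Kolmogorov property such that
`(P_t f - f) / t → L f` in supremum norm as `t ↓ 0`, for every bounded measurable `f`. -/
structure IsTransitionSemigroup {S : Type*} [MeasurableSpace S] (L : (S → ℝ) → S → ℝ)
    (P : ℝ≥0 → Kernel S S) : Prop where
  markov : ∀ t, IsMarkovKernel (P t)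
  zero : P 0 = Kernel.id
  add : ∀ s t, P (s + t) = P t ∘ₖ P s
  gen : ∀ f : S → ℝ, Measurable f → (∃ C, ∀ ξ, |f ξ| ≤ C) →
    TendstoUniformly (fun (t : ℝ≥0) ξ => (∫ η, f η ∂(P t ξ) - f ξ) / (t : ℝ)) (L f) (𝓝[>] 0)

/-- `μ` is an invariant measure of (the Markov process with) the generator `L`. -/
def IsInvariantMeasure {S : Type*} [MeasurableSpace S] (L : (S → ℝ) → S → ℝ)
    (μ : Measure S) : Prop :=
  ∃ P : ℝ≥0 → Kernel S S, IsTransitionSemigroup L P ∧ ∀ t, Kernel.Invariant (P t) μ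

/-- Exponential tightness: for every `M > 0` there is a compact set `K` with
`limsup_N (1/N) log μ_N(Kᶜ) ≤ -M` (with `log 0 = -∞`). -/
def ExponentiallyTight {X : Type*} [TopologicalSpace X] [MeasurableSpace X]
    (μ : ℕ+ → Measure X) : Prop :=
  ∀ M : ℝ, 0 < M → ∃ K : Set X, IsCompact K ∧
    limsup (fun N : ℕ+ => ENNReal.log (μ N Kᶜ) / ((N : ℕ) : EReal)) atTop ≤ ((-M : ℝ) : EReal)

/-- The set of `ξ` with `∑_z ξ(z) z log z ≤ M` (where `0 log 0 = 0`). -/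
def KM (M : ℝ) : Set M1 :=
  {ξ | ∫⁻ z : ℕ, ENNReal.ofReal ((z : ℝ) * Real.log (z : ℝ)) ∂(ξ : Measure ℕ)
    ≤ ENNReal.ofReal M}

/-- Edge set `{(z, z+1) : z ≥ 0} ∪ {(z, 0) : z ≥ 1}`. -/
def AssumptionA1 (E : Set (ℕ × ℕ)) : Prop :=
  E = {e | ∃ z : ℕ, e = (z, z + 1)} ∪ {e | ∃ z : ℕ, z ≠ 0 ∧ e = (z, 0)}

/-- Forward rates of order `1/(z+1)` and backward rates of order one, uniformly in `ξ`. -/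
def AssumptionA2 (lo hi : ℝ) (lam : ℕ → ℕ → M1 → ℝ) : Prop :=
  ∀ ξ : M1,
    (∀ z : ℕ, lo / (z + 1) ≤ lam z (z + 1) ξ ∧ lam z (z + 1) ξ ≤ hi / (z + 1)) ∧
    (∀ z : ℕ, z ≠ 0 → lo ≤ lam z 0 ξ ∧ lam z 0 ξ ≤ hi)

end MeanField

end

/-!
The state space `M1N N` is countable and discrete, and the total jump rate of the `N` particles is
at most `2 N hi`. So the generator is `c (Q - 1)` for a Markov kernel `Q` (`particleChain`), a
bounded operator on bounded functions. Its exponentials are the Poisson mixtures of the powers of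
`Q`, hence Markov kernels; and the orbits of any semigroup with this generator solve the linear
equation `w' = c (Q - 1) w`, which has unique solutions
(`IsUniformization.existsUnique_semigroup`). Being invariant for the semigroup is the same as being
invariant for `Q` (`IsUniformization.isInvariantMeasure_iff`).

Every particle away from `0` returns to `0` at rate at least `lo`, whatever the others do. So `Q`
collects all particles at `0` within `N` steps with a probability bounded below, uniformly in the
initial state. This Doeblin condition gives exactly one invariant distribution `μ`
(`existsUnique_invariant_of_pow_le_atom`).

For the tail estimate let `φ z = z log z` and `u = exp (β φ) - 1`, truncated to be bounded. The
increment of `φ` at `z` is at most `1 + log (z + 1)`, so for `β = min 1 (lo / (2 e hi))` the forward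
rate `hi / (z + 1)` produces at most `(lo / 2) (1 + u z)`, while the jump to `0` contributes at
most `-lo (u z)`: a single particle satisfies `A u ≤ (lo / 2) (1 - u)`, uniformly in the empirical
measure (`truncExp_drift`). The exponential of the sum of the `φ (xᵢ)` is not a Lyapunov function
(a few particles far out are compatible with a positive drift coming from those near `0`). Instead
put `V s = ∏ᵢ (1 + s u(xᵢ))`; the drift inequality yields `L (V s) ≤ s (lo / 2) (N V s - ∂ₛ V s)`.
Integrating against `μ` gives `G' ≤ N G` for `G s = ∫ V s dμ`, so `G 1 ≤ exp N`
(`integral_prodFn_le_exp`). Now `V 1` is the product of the `exp (β φ(xᵢ))`, which exceeds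
`exp (N M β)` outside `KM M`, and Chebyshev's inequality ends the proof. Exponential tightness
follows since `KM M` is a tight set.
-/

noncomputable section

namespace MeanField

/-! ### Bounded functions on a discrete state space -/

section BoundedFunctions

open scoped BoundedContinuousFunction

theorem abs_apply_le_norm {S : Type*} [TopologicalSpace S] (f : S →ᵇ ℝ) (x : S) : |f x| ≤ ‖f‖ :=
  f.norm_coe_le_norm x

variable {S : Type*} [MeasurableSpace S]

theorem abs_integral_le_of_forall_abs_le {μ : Measure S} [IsProbabilityMeasure μ] {f : S → ℝ}
    {C : ℝ} (hf : ∀ x, |f x| ≤ C) : |∫ x, f x ∂μ| ≤ C := by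
  simpa using norm_integral_le_of_norm_le_const (μ := μ) (f := f) (C := C) (ae_of_all _ hf)

theorem measure_ext_of_integral_eq {μ ν : Measure S} [IsProbabilityMeasure μ]
    [IsProbabilityMeasure ν]
    (h : ∀ f : S → ℝ, (∃ C, ∀ x, |f x| ≤ C) → ∫ x, f x ∂μ = ∫ x, f x ∂ν) : μ = ν := by
  ext A hA
  have hb : ∀ x, |A.indicator (1 : S → ℝ) x| ≤ 1 := fun x => by
    by_cases hx : x ∈ A <;> simp [hx]
  have := h (A.indicator 1) ⟨1, hb⟩
  rw [integral_indicator_one hA, integral_indicator_one hA] at this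
  exact (measureReal_eq_measureReal_iff).1 this

theorem invariant_pow {Q : Kernel S S} {μ : Measure S} (h : μ.bind Q = μ) (n : ℕ) :
    μ.bind (Q ^ n : Kernel S S) = μ := by
  induction n with
  | zero => exact Measure.bind_dirac
  | succ n ih =>
    rw [pow_succ]
    refine (Measure.comp_assoc (κ := Q) (η := Q ^ n)).symm.trans ?_
    rw [h, ih]

variable [DiscreteMeasurableSpace S]

theorem integrable_of_forall_abs_le {μ : Measure S} [IsFiniteMeasure μ] {f : S → ℝ} {C : ℝ}
    (hf : ∀ x, |f x| ≤ C) : Integrable f μ :=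
  Integrable.of_bound Measurable.of_discrete.aestronglyMeasurable C (ae_of_all _ hf)

theorem integral_bind_kernel {T : Type*} [MeasurableSpace T] {m : Measure T} [IsFiniteMeasure m]
    (κ : Kernel T S) [IsMarkovKernel κ] {f : S → ℝ} {C : ℝ} (hf : ∀ x, |f x| ≤ C) :
    ∫ x, f x ∂(m.bind κ) = ∫ t, ∫ x, f x ∂(κ t) ∂m := by
  have h := Kernel.integral_comp (κ := Kernel.const Unit m) (η := κ) (a := ()) (f := f)
    (integrable_of_forall_abs_le hf)
  simpa [Kernel.comp_apply] using h

variable [TopologicalSpace S] [DiscreteTopology S]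

/-- The operator `f ↦ (x ↦ ∫ f dκ(x, ·))` of a Markov kernel `κ` on bounded functions. The state
space is discrete, so every bounded function is a bounded continuous function. -/
def markovOp (κ : Kernel S S) [IsMarkovKernel κ] : (S →ᵇ ℝ) →L[ℝ] (S →ᵇ ℝ) :=
  LinearMap.mkContinuous
    { toFun := fun f => BoundedContinuousFunction.ofNormedAddCommGroupDiscrete
        (fun x => ∫ y, f y ∂(κ x)) ‖f‖
        (fun _ => abs_integral_le_of_forall_abs_le (abs_apply_le_norm f))
      map_add' := fun f g => by
        ext x
        exact integral_add (integrable_of_forall_abs_le (abs_apply_le_norm f))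
          (integrable_of_forall_abs_le (abs_apply_le_norm g))
      map_smul' := fun r f => by
        ext x
        exact integral_const_mul r _ }
    1 (fun f => by
      rw [one_mul]
      exact (BoundedContinuousFunction.norm_le (norm_nonneg f)).2
        fun _ => abs_integral_le_of_forall_abs_le (abs_apply_le_norm f))

@[simp]
theorem markovOp_apply (κ : Kernel S S) [IsMarkovKernel κ] (f : S →ᵇ ℝ) (x : S) :
    markovOp κ f x = ∫ y, f y ∂(κ x) := rfl

theorem norm_markovOp_apply_le (κ : Kernel S S) [IsMarkovKernel κ] (f : S →ᵇ ℝ) :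
    ‖markovOp κ f‖ ≤ ‖f‖ :=
  (BoundedContinuousFunction.norm_le (norm_nonneg f)).2
    fun _ => abs_integral_le_of_forall_abs_le (abs_apply_le_norm f)

theorem markovOp_comp (κ η : Kernel S S) [IsMarkovKernel κ] [IsMarkovKernel η] :
    markovOp (κ ∘ₖ η) = markovOp η * markovOp κ := by
  ext f x
  exact Kernel.integral_comp (integrable_of_forall_abs_le (abs_apply_le_norm f))

theorem markovOp_id : markovOp (Kernel.id : Kernel S S) = 1 := by
  ext f x
  simp [Kernel.id_apply]

theorem markovOp_congr {κ η : Kernel S S} [IsMarkovKernel κ] [IsMarkovKernel η] (h : κ = η) :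
    markovOp κ = markovOp η := by
  subst h
  rfl

theorem markovOp_injective {κ η : Kernel S S} [IsMarkovKernel κ] [IsMarkovKernel η]
    (h : markovOp κ = markovOp η) : κ = η := by
  ext1 x
  refine measure_ext_of_integral_eq fun f ⟨C, hC⟩ => ?_
  exact congrArg (fun T : (S →ᵇ ℝ) →L[ℝ] (S →ᵇ ℝ) =>
    T (BoundedContinuousFunction.ofNormedAddCommGroupDiscrete f C hC) x) h

instance isMarkovKernel_pow (κ : Kernel S S) [IsMarkovKernel κ] (n : ℕ) :
    IsMarkovKernel (κ ^ n) := by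
  induction n with
  | zero => exact inferInstanceAs (IsMarkovKernel (Kernel.id : Kernel S S))
  | succ n ih =>
    rw [pow_succ]
    exact inferInstanceAs (IsMarkovKernel ((κ ^ n) ∘ₖ κ))

theorem markovOp_pow (κ : Kernel S S) [IsMarkovKernel κ] (n : ℕ) :
    markovOp (κ ^ n) = markovOp κ ^ n := by
  induction n with
  | zero => exact markovOp_id
  | succ n ih =>
    rw [pow_succ (markovOp κ), ← ih, ← markovOp_comp]
    exact markovOp_congr (pow_succ' κ n)

end BoundedFunctions

/-! ### Exponentials in a Banach algebra -/

section BanachAlgebra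

variable {𝔸 : Type*} [NormedRing 𝔸] [NormedAlgebra ℝ 𝔸] [CompleteSpace 𝔸]

theorem exp_add_smul (a : 𝔸) (s t : ℝ) :
    NormedSpace.exp ((s + t) • a) = NormedSpace.exp (s • a) * NormedSpace.exp (t • a) := by
  let _ : NormedAlgebra ℚ 𝔸 := NormedAlgebra.restrictScalars ℚ ℝ 𝔸
  rw [add_smul, NormedSpace.exp_add_of_commute]
  exact ((Commute.refl _).smul_left _).smul_right _

theorem exp_smul_smul_sub_one (a : 𝔸) (c t : ℝ) :
    NormedSpace.exp (t • (c • (a - 1)))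
      = Real.exp (-(c * t)) • NormedSpace.exp ((c * t) • a) := by
  let _ : NormedAlgebra ℚ 𝔸 := NormedAlgebra.restrictScalars ℚ ℝ 𝔸
  have : t • (c • (a - 1)) = algebraMap ℝ 𝔸 (-(c * t)) + (c * t) • a := by
    rw [Algebra.algebraMap_eq_smul_one]
    module
  rw [this, NormedSpace.exp_add_of_commute (Algebra.commutes _ _),
    ← NormedSpace.algebraMap_exp_comm, ← Real.exp_eq_exp_ℝ, Algebra.algebraMap_eq_smul_one,
    smul_mul_assoc, one_mul]

theorem hasSum_exp_smul (a : 𝔸) (r : ℝ) :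
    HasSum (fun n : ℕ => (r ^ n / n.factorial) • a ^ n) (NormedSpace.exp (r • a)) := by
  convert NormedSpace.exp_series_hasSum_exp' (𝕂 := ℝ) (r • a) using 2 with n
  rw [smul_pow, smul_smul, div_eq_inv_mul]

end BanachAlgebra

/-! ### Uniformization: semigroups with a bounded generator -/

section Uniformization

open scoped BoundedContinuousFunction

variable {S : Type*} [MeasurableSpace S] [DiscreteMeasurableSpace S]

/-- The transition kernel at time `t` of the process that makes the steps of the Markov chain `Q`
at the events of a Poisson process of rate `c`. -/
def poissonizedKernel [Countable S] (c : ℝ≥0) (Q : Kernel S S) (t : ℝ≥0) : Kernel S S :=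
  Kernel.ofFunOfCountable fun x =>
    (poissonMeasure (c * t)).bind (Kernel.ofFunOfCountable fun n : ℕ => (Q ^ n) x)

/-- The operator `L` is `f ↦ c (Q f - f)` on bounded functions. -/
def IsUniformization (L : (S → ℝ) → S → ℝ) (c : ℝ≥0) (Q : Kernel S S) : Prop :=
  ∀ f : S → ℝ, (∃ C, ∀ x, |f x| ≤ C) → ∀ x, L f x = c * (∫ y, f y ∂(Q x) - f x)

variable [TopologicalSpace S] [DiscreteTopology S]

-- `NormedSpace.exp` asks for this instance, which the default synthesis depth does not reach.
set_option maxSynthPendingDepth 3 in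
instance isTopologicalRing_boundedOperators :
    IsTopologicalRing ((S →ᵇ ℝ) →L[ℝ] (S →ᵇ ℝ)) := inferInstance

/-- The bounded operator `c (Q - 1)` on bounded functions. -/
def uniformizedGen (c : ℝ≥0) (Q : Kernel S S) [IsMarkovKernel Q] :
    (S →ᵇ ℝ) →L[ℝ] (S →ᵇ ℝ) :=
  (c : ℝ) • (markovOp Q - 1)

theorem IsUniformization.apply {L : (S → ℝ) → S → ℝ} {c : ℝ≥0} {Q : Kernel S S}
    [IsMarkovKernel Q] (hL : IsUniformization L c Q) (f : S →ᵇ ℝ) :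
    L f = uniformizedGen c Q f := by
  ext x
  rw [hL f ⟨_, abs_apply_le_norm f⟩ x]
  simp [uniformizedGen]

/-- Orbits of a transition semigroup solve `w' = L w`, so they are determined by the generator. -/
theorem IsTransitionSemigroup.markovOp_eq_exp {L : (S → ℝ) → S → ℝ} {c : ℝ≥0} {Q : Kernel S S}
    [IsMarkovKernel Q] (hL : IsUniformization L c Q) {P : ℝ≥0 → Kernel S S}
    (hP : IsTransitionSemigroup L P) (t : ℝ≥0) :
    haveI := hP.markov t
    markovOp (P t) = NormedSpace.exp ((t : ℝ) • uniformizedGen c Q) := by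
  have := hP.markov
  set A := uniformizedGen c Q
  have hslope : ∀ f : S →ᵇ ℝ, Tendsto (fun h : ℝ≥0 => (h : ℝ)⁻¹ • (markovOp (P h) f - f))
      (𝓝[>] 0) (𝓝 (A f)) := fun f => by
    rw [BoundedContinuousFunction.tendsto_iff_tendstoUniformly, ← hL.apply f]
    convert hP.gen f Measurable.of_discrete ⟨_, abs_apply_le_norm f⟩ using 3 with h x
    simp [div_eq_inv_mul]
  have hreal : Tendsto Real.toNNReal (𝓝[>] 0) (𝓝[>] 0) :=
    tendsto_nhdsWithin_iff.2 ⟨(continuous_real_toNNReal.tendsto' 0 0 (by simp)).mono_left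
      nhdsWithin_le_nhds, eventually_nhdsWithin_of_forall fun t ht => by simpa using ht⟩
  have hadd : ∀ s t f, markovOp (P (s + t)) f = markovOp (P s) (markovOp (P t) f) :=
    fun s t f => by
      rw [markovOp_congr (hP.add s t), markovOp_comp]; rfl
  ext1 f
  set w : ℝ → (S →ᵇ ℝ) := fun s => markovOp (P s.toNNReal) f with hw
  have hw0 : w 0 = f := by
    simp [hw, markovOp_congr hP.zero, markovOp_id]
  have hderiv : ∀ s : ℝ, 0 ≤ s → HasDerivWithinAt w (A (w s)) (Set.Ici s) s := fun s hs => by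
    rw [hasDerivWithinAt_iff_tendsto_slope, Set.Ici_sdiff_left]
    have h1 := (hslope (w s)).comp hreal
    have h2 : Tendsto (fun r => r - s) (𝓝[>] s) (𝓝[>] 0) :=
      tendsto_nhdsWithin_iff.2 ⟨((continuous_id.sub continuous_const).tendsto' s 0
        (by simp)).mono_left nhdsWithin_le_nhds,
        eventually_nhdsWithin_of_forall fun r hr => by simpa using hr⟩
    refine (h1.comp h2).congr' (eventually_nhdsWithin_of_forall fun r hr => ?_)
    have hr' : s < r := hr
    have h3 : r.toNNReal = (r - s).toNNReal + s.toNNReal := by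
      rw [← Real.toNNReal_add (by linarith) hs]; simp
    simp only [Function.comp, slope_def_module, hw]
    rw [h3, hadd, Real.coe_toNNReal _ (by linarith)]
  -- Left continuity holds because `‖w r - w s‖ ≤ ‖w (r - s) - w 0‖` for `s ≤ r`.
  have hmod : ∀ s r : ℝ, 0 ≤ s → s ≤ r → ‖w r - w s‖ ≤ ‖w (r - s) - f‖ := fun s r hs hsr => by
    have h3 : r.toNNReal = s.toNNReal + (r - s).toNNReal := by
      rw [← Real.toNNReal_add hs (by linarith)]; simp
    simp only [hw]
    rw [h3, hadd, ← map_sub]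
    exact norm_markovOp_apply_le _ _
  have hcont : ContinuousOn w (Set.Ici 0) := fun s hs => by
    have h0 : Tendsto (fun r : ℝ => ‖w |r - s| - f‖) (𝓝[Set.Ici 0] s) (𝓝 0) := by
      have h1 : Tendsto w (𝓝[≥] 0) (𝓝 f) := by
        simpa [hw0] using (hderiv 0 le_rfl).continuousWithinAt.tendsto
      have h2 : Tendsto (fun r : ℝ => |r - s|) (𝓝[Set.Ici 0] s) (𝓝[≥] 0) :=
        tendsto_nhdsWithin_iff.2 ⟨((continuous_abs.comp (continuous_id.sub
          continuous_const)).tendsto' s 0 (by simp)).mono_left nhdsWithin_le_nhds,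
          Eventually.of_forall fun r => Set.mem_Ici.2 (abs_nonneg _)⟩
      simpa using ((h1.comp h2).sub_const f).norm
    rw [ContinuousWithinAt, tendsto_iff_norm_sub_tendsto_zero]
    refine squeeze_zero' (Eventually.of_forall fun _ => norm_nonneg _)
      (eventually_nhdsWithin_of_forall fun r (hr : 0 ≤ r) => ?_) h0
    rcases le_total s r with h | h
    · rw [abs_of_nonneg (by linarith)]; exact hmod s r hs h
    · rw [abs_sub_comm, abs_of_nonneg (by linarith), norm_sub_rev]; exact hmod r s hr h
  have hexp : ∀ s : ℝ, HasDerivAt (fun s : ℝ => NormedSpace.exp (s • A) f)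
      (A (NormedSpace.exp (s • A) f)) s := fun s => by
    simpa using (hasDerivAt_exp_smul_const' (𝕂 := ℝ) A s).clm_apply (hasDerivAt_const s f)
  have := ODE_solution_unique_of_mem_Icc_right (v := fun _ g => A g) (s := fun _ => Set.univ)
    (K := ‖A‖₊) (f := w) (g := fun s : ℝ => NormedSpace.exp (s • A) f) (a := 0) (b := t)
    (fun _ _ => A.lipschitz.lipschitzOnWith) (hcont.mono fun s hs => hs.1)
    (fun s hs => hderiv s hs.1) (fun _ _ => trivial)
    (fun s _ => (hexp s).continuousAt.continuousWithinAt)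
    (fun s _ => (hexp s).hasDerivWithinAt) (fun _ _ => trivial) (by simp [hw0])
  have h5 := this (Set.right_mem_Icc.2 t.2)
  simpa [hw] using h5

theorem exp_smul_uniformizedGen (c : ℝ≥0) (Q : Kernel S S) [IsMarkovKernel Q] (t : ℝ) :
    NormedSpace.exp (t • uniformizedGen c Q)
      = Real.exp (-(c * t)) • NormedSpace.exp ((c * t) • markovOp Q) :=
  exp_smul_smul_sub_one (markovOp Q) c t

variable [Countable S]

instance isMarkovKernel_ofFun_pow (Q : Kernel S S) [IsMarkovKernel Q] (x : S) :
    IsMarkovKernel (Kernel.ofFunOfCountable fun n : ℕ => (Q ^ n) x) :=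
  ⟨fun n => inferInstanceAs (IsProbabilityMeasure ((Q ^ n) x))⟩

instance isMarkovKernel_poissonizedKernel (c : ℝ≥0) (Q : Kernel S S) [IsMarkovKernel Q]
    (t : ℝ≥0) : IsMarkovKernel (poissonizedKernel c Q t) :=
  ⟨fun x => inferInstanceAs (IsProbabilityMeasure
    ((poissonMeasure (c * t)).bind (Kernel.ofFunOfCountable fun n : ℕ => (Q ^ n) x)))⟩

/-- On bounded functions the poissonized kernels are the exponentials of the generator. -/
theorem markovOp_poissonizedKernel (c : ℝ≥0) (Q : Kernel S S) [IsMarkovKernel Q] (t : ℝ≥0) :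
    markovOp (poissonizedKernel c Q t) = NormedSpace.exp ((t : ℝ) • uniformizedGen c Q) := by
  rw [exp_smul_uniformizedGen]
  ext f x
  have h1 : markovOp (poissonizedKernel c Q t) f x
      = ∫ n, (markovOp Q ^ n) f x ∂(poissonMeasure (c * t)) := by
    rw [markovOp_apply]
    refine (integral_bind_kernel _ (abs_apply_le_norm f)).trans ?_
    refine integral_congr_ae (ae_of_all _ fun n => ?_)
    simp only [← markovOp_pow]
    rfl
  rw [h1, integral_poissonMeasure]
  have h2 := hasSum_exp_smul (markovOp Q) (c * t)
  have h3 := ((h2.mapL (ContinuousLinearMap.apply ℝ (S →ᵇ ℝ) f)).mapL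
    (BoundedContinuousFunction.evalCLM ℝ x)).mul_left (Real.exp (-(c * t)))
  refine Eq.trans ?_ h3.tsum_eq
  refine tsum_congr fun n => ?_
  simp
  ring

theorem IsUniformization.isTransitionSemigroup {L : (S → ℝ) → S → ℝ} {c : ℝ≥0} {Q : Kernel S S}
    [IsMarkovKernel Q] (hL : IsUniformization L c Q) :
    IsTransitionSemigroup L (poissonizedKernel c Q) := by
  refine ⟨inferInstance, ?_, fun s t => ?_, fun f _ ⟨C, hC⟩ => ?_⟩
  · apply markovOp_injective
    rw [markovOp_poissonizedKernel, markovOp_id]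
    simp
  · apply markovOp_injective
    rw [markovOp_comp, markovOp_poissonizedKernel, markovOp_poissonizedKernel,
      markovOp_poissonizedKernel, NNReal.coe_add]
    exact exp_add_smul (uniformizedGen c Q) s t
  · set F : S →ᵇ ℝ := BoundedContinuousFunction.ofNormedAddCommGroupDiscrete f C hC with hF
    have h1 := ((hasDerivAt_exp_smul_const (𝕂 := ℝ) (uniformizedGen c Q) 0).clm_apply
      (hasDerivAt_const (0 : ℝ) F)).tendsto_slope_zero_right
    have h2 : Tendsto (fun t : ℝ≥0 => (t : ℝ)) (𝓝[>] 0) (𝓝[>] 0) :=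
      tendsto_nhdsWithin_iff.2 ⟨(NNReal.continuous_coe.tendsto' 0 0 rfl).mono_left
        nhdsWithin_le_nhds, eventually_nhdsWithin_of_forall fun t ht => by simpa using ht⟩
    have h3 := BoundedContinuousFunction.tendsto_iff_tendstoUniformly.1 (h1.comp h2)
    have h4 : L f = uniformizedGen c Q F := hL.apply F
    rw [h4]
    convert h3 using 1
    · ext t x
      have : ∫ η, f η ∂(poissonizedKernel c Q t x)
          = NormedSpace.exp ((t : ℝ) • uniformizedGen c Q) F x := by
        rw [← markovOp_poissonizedKernel]; rfl
      rw [this]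
      simp [hF, div_eq_inv_mul]
    · ext x
      simp

end Uniformization

section UniformizationConsequences

variable {S : Type*} [MeasurableSpace S] [DiscreteMeasurableSpace S]

theorem IsUniformization.integral_eq_zero {L : (S → ℝ) → S → ℝ} {c : ℝ≥0} {Q : Kernel S S}
    [IsMarkovKernel Q] (hL : IsUniformization L c Q) {μ : Measure S} [IsProbabilityMeasure μ]
    (hμ : μ.bind Q = μ) (f : S → ℝ) (hf : ∃ C, ∀ x, |f x| ≤ C) :
    Integrable (L f) μ ∧ ∫ x, L f x ∂μ = 0 := by
  obtain ⟨C, hC⟩ := hf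
  have h1 : Integrable (fun x => ∫ y, f y ∂(Q x)) μ :=
    integrable_of_forall_abs_le fun x => abs_integral_le_of_forall_abs_le hC
  have h2 : Integrable f μ := integrable_of_forall_abs_le hC
  have h3 : L f = fun x => c * (∫ y, f y ∂(Q x) - f x) := funext (hL f ⟨C, hC⟩)
  rw [h3]
  refine ⟨(h1.sub h2).const_mul _, ?_⟩
  rw [integral_const_mul, integral_sub h1 h2, ← integral_bind_kernel Q hC, hμ, sub_self, mul_zero]

variable [Countable S]

theorem IsUniformization.existsUnique_semigroup {L : (S → ℝ) → S → ℝ} {c : ℝ≥0} {Q : Kernel S S}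
    [IsMarkovKernel Q] (hL : IsUniformization L c Q) :
    ∃! P : ℝ≥0 → Kernel S S, IsTransitionSemigroup L P := by
  let _ : TopologicalSpace S := ⊥
  have _ : DiscreteTopology S := ⟨rfl⟩
  refine ⟨_, hL.isTransitionSemigroup, fun P hP => funext fun t => ?_⟩
  have := hP.markov t
  apply markovOp_injective
  rw [hP.markovOp_eq_exp hL, markovOp_poissonizedKernel]

/-- Invariance under the semigroup amounts to invariance under one step of the chain. -/
theorem IsUniformization.isInvariantMeasure_iff {L : (S → ℝ) → S → ℝ} {c : ℝ≥0} {Q : Kernel S S}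
    [IsMarkovKernel Q] (hL : IsUniformization L c Q) (hc : c ≠ 0) (μ : Measure S)
    [IsProbabilityMeasure μ] :
    IsInvariantMeasure L μ ↔ μ.bind Q = μ := by
  let _ : TopologicalSpace S := ⊥
  have _ : DiscreteTopology S := ⟨rfl⟩
  constructor
  -- Differentiating `∫ P_t f dμ = ∫ f dμ` at `t = 0` gives `∫ L f dμ = 0`.
  · rintro ⟨P, hP, hinv⟩
    have := hP.markov
    refine measure_ext_of_integral_eq fun f ⟨C, hC⟩ => ?_
    have hQf : ∀ x, |∫ y, f y ∂(Q x)| ≤ C := fun x => abs_integral_le_of_forall_abs_le hC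
    have hLf : ∫ x, L f x ∂μ = 0 := by
      have h1 : Tendsto (fun t : ℝ≥0 => ∫ x, (∫ η, f η ∂(P t x) - f x) / (t : ℝ) ∂μ) (𝓝[>] 0)
          (𝓝 (∫ x, L f x ∂μ)) := by
        rw [Metric.tendsto_nhds]
        intro ε hε
        have hg := Metric.tendstoUniformly_iff.1 (hP.gen f Measurable.of_discrete ⟨C, hC⟩)
          (ε / 2) (by positivity)
        filter_upwards [hg] with t ht
        have hi1 : Integrable (fun x => (∫ η, f η ∂(P t x) - f x) / (t : ℝ)) μ :=
          ((integrable_of_forall_abs_le fun x => abs_integral_le_of_forall_abs_le hC).sub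
            (integrable_of_forall_abs_le hC)).div_const _
        have hi2 : Integrable (L f) μ := by
          have : L f = fun x => c * (∫ y, f y ∂(Q x) - f x) := funext (hL f ⟨C, hC⟩)
          rw [this]
          exact ((integrable_of_forall_abs_le hQf).sub
            (integrable_of_forall_abs_le hC)).const_mul _
        rw [Real.dist_eq, ← integral_sub hi1 hi2]
        refine (abs_integral_le_of_forall_abs_le (C := ε / 2) fun x => ?_).trans_lt (by linarith)
        have := (ht x).le
        rwa [dist_comm, Real.dist_eq] at this
      refine tendsto_nhds_unique h1 (tendsto_const_nhds.congr fun t => ?_)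
      have hi : ∫ x, ∫ η, f η ∂(P t x) ∂μ = ∫ x, f x ∂μ := by
        have h3 : μ.bind (P t) = μ := hinv t
        conv_rhs => rw [← h3]
        exact (integral_bind_kernel (P t) hC).symm
      rw [integral_div, integral_sub (integrable_of_forall_abs_le fun x =>
        abs_integral_le_of_forall_abs_le hC) (integrable_of_forall_abs_le hC), hi]
      simp
    simp_rw [hL f ⟨C, hC⟩] at hLf
    rw [integral_const_mul, integral_sub (integrable_of_forall_abs_le hQf)
      (integrable_of_forall_abs_le hC)] at hLf
    rw [integral_bind_kernel Q hC]
    have : (c : ℝ) ≠ 0 := by exact_mod_cast hc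
    have := (mul_eq_zero.1 hLf).resolve_left this
    linarith
  · intro h
    refine ⟨_, hL.isTransitionSemigroup, fun t => ?_⟩
    change μ.bind (poissonizedKernel c Q t) = μ
    refine measure_ext_of_integral_eq fun f ⟨C, hC⟩ => ?_
    rw [integral_bind_kernel _ hC]
    have h1 : ∀ x, ∫ y, f y ∂(poissonizedKernel c Q t x)
        = ∫ n, ∫ y, f y ∂((Q ^ n : Kernel S S) x) ∂(poissonMeasure (c * t)) := fun x =>
      integral_bind_kernel (Kernel.ofFunOfCountable fun n : ℕ => (Q ^ n) x) hC
    simp_rw [h1]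
    rw [integral_integral_swap]
    · have h2 : ∀ n : ℕ, ∫ x, ∫ y, f y ∂((Q ^ n : Kernel S S) x) ∂μ = ∫ x, f x ∂μ := fun n => by
        rw [← integral_bind_kernel _ hC, invariant_pow h]
      simp [h2]
    · exact integrable_of_forall_abs_le fun p => abs_integral_le_of_forall_abs_le hC

end UniformizationConsequences

/-! ### Invariant distributions under a Doeblin condition -/

section Doeblin

variable {S : Type*} [MeasurableSpace S] {K : Kernel S S} {ε : ℝ≥0} {o : S}

theorem le_one_of_le_atom [IsMarkovKernel K] (h : ∀ x, (ε : ℝ≥0∞) ≤ K x {o}) : ε ≤ 1 := by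
  exact_mod_cast (h o).trans prob_le_one

variable [DiscreteMeasurableSpace S] [Countable S]

/-- What remains of the kernel `K` when an atom of mass `ε` at `o` is removed from every
transition probability. -/
def removeAtom (K : Kernel S S) (ε : ℝ≥0) (o : S) : Kernel S S :=
  Kernel.ofFunOfCountable fun x => K x - (ε : ℝ≥0∞) • Measure.dirac o

theorem removeAtom_add (h : ∀ x, (ε : ℝ≥0∞) ≤ K x {o}) (x : S) :
    removeAtom K ε o x + (ε : ℝ≥0∞) • Measure.dirac o = K x := by
  have : IsFiniteMeasure ((ε : ℝ≥0∞) • Measure.dirac o) :=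
    inferInstanceAs (IsFiniteMeasure (ε • Measure.dirac o))
  refine Measure.sub_add_cancel_of_le (Measure.le_iff.2 fun A hA => ?_)
  by_cases ho : o ∈ A
  · simpa [ho] using (h x).trans (measure_mono (Set.singleton_subset_iff.2 ho))
  · simp [ho]

theorem removeAtom_univ [IsMarkovKernel K] (h : ∀ x, (ε : ℝ≥0∞) ≤ K x {o}) (x : S) :
    removeAtom K ε o x Set.univ = 1 - ε := by
  have := congrArg (fun m : Measure S => m Set.univ) (removeAtom_add h x)
  simp only [Measure.add_apply, Measure.smul_apply, measure_univ, smul_eq_mul, mul_one] at this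
  rw [← this, ENNReal.add_sub_cancel_right ENNReal.coe_ne_top]

theorem integral_eq_removeAtom_add [IsMarkovKernel K] (h : ∀ x, (ε : ℝ≥0∞) ≤ K x {o})
    {f : S → ℝ} {C : ℝ} (hf : ∀ x, |f x| ≤ C) (x : S) :
    ∫ y, f y ∂(K x) = ∫ y, f y ∂(removeAtom K ε o x) + ε * f o := by
  have h1 : IsFiniteMeasure (removeAtom K ε o x) := ⟨by
    rw [removeAtom_univ h]; exact tsub_le_self.trans_lt ENNReal.one_lt_top⟩
  have h2 : IsFiniteMeasure ((ε : ℝ≥0∞) • Measure.dirac o) :=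
    inferInstanceAs (IsFiniteMeasure (ε • Measure.dirac o))
  rw [← removeAtom_add h x, integral_add_measure (integrable_of_forall_abs_le hf)
    (integrable_of_forall_abs_le hf), integral_smul_measure]
  simp

theorem abs_integral_removeAtom_le [IsMarkovKernel K] (h : ∀ x, (ε : ℝ≥0∞) ≤ K x {o})
    {f : S → ℝ} {C : ℝ} (hf : ∀ x, |f x| ≤ C) (x : S) :
    |∫ y, f y ∂(removeAtom K ε o x)| ≤ C * (1 - ε) := by
  have h1 : IsFiniteMeasure (removeAtom K ε o x) := ⟨by
    rw [removeAtom_univ h]; exact tsub_le_self.trans_lt ENNReal.one_lt_top⟩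
  have h2 := norm_integral_le_of_norm_le_const (μ := removeAtom K ε o x) (f := f) (C := C)
    (ae_of_all _ hf)
  rwa [measureReal_def, removeAtom_univ h, ENNReal.toReal_sub_of_le
    (by exact_mod_cast le_one_of_le_atom h) ENNReal.one_ne_top] at h2

/-- Two invariant distributions agree, because one step of the chain shrinks the difference of
their integrals by the factor `1 - ε`. -/
theorem eq_of_invariant_of_le_atom [IsMarkovKernel K] (hε : 0 < ε)
    (h : ∀ x, (ε : ℝ≥0∞) ≤ K x {o}) {μ ν : Measure S} [IsProbabilityMeasure μ]
    [IsProbabilityMeasure ν] (hμ : μ.bind K = μ) (hν : ν.bind K = ν) : μ = ν := by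
  have hε1 : (ε : ℝ) ≤ 1 := by exact_mod_cast le_one_of_le_atom h
  have key : ∀ (k : ℕ) (f : S → ℝ) (C : ℝ), (∀ x, |f x| ≤ C) →
      |∫ x, f x ∂μ - ∫ x, f x ∂ν| ≤ 2 * C * (1 - ε) ^ k := by
    intro k
    induction k with
    | zero =>
      intro f C hf
      have h1 := abs_integral_le_of_forall_abs_le (μ := μ) hf
      have h2 := abs_integral_le_of_forall_abs_le (μ := ν) hf
      have h3 := abs_sub (∫ x, f x ∂μ) (∫ x, f x ∂ν)
      simp only [pow_zero, mul_one]
      linarith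
    | succ k ih =>
      intro f C hf
      have hstep : ∀ (ρ : Measure S) [IsProbabilityMeasure ρ], ρ.bind K = ρ →
          ∫ x, f x ∂ρ = ∫ x, ∫ y, f y ∂(removeAtom K ε o x) ∂ρ + ε * f o := by
        intro ρ _ hρ
        conv_lhs => rw [← hρ]
        rw [integral_bind_kernel K hf]
        simp_rw [integral_eq_removeAtom_add h hf]
        rw [integral_add (integrable_of_forall_abs_le (abs_integral_removeAtom_le h hf))
          (integrable_const _)]
        simp
      rw [hstep μ hμ, hstep ν hν, add_sub_add_right_eq_sub]
      refine (ih _ _ (abs_integral_removeAtom_le h hf)).trans_eq ?_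
      ring
  refine measure_ext_of_integral_eq fun f ⟨C, hC⟩ => ?_
  have hlim : Tendsto (fun k : ℕ => 2 * C * (1 - (ε : ℝ)) ^ k) atTop (𝓝 0) := by
    have hε0 : (0 : ℝ) < ε := hε
    simpa using (tendsto_pow_atTop_nhds_zero_of_lt_one (r := 1 - (ε : ℝ)) (by linarith)
      (by linarith)).const_mul (2 * C)
  have := ge_of_tendsto' hlim fun k => key k f C hC
  exact sub_eq_zero.1 (abs_eq_zero.1 (le_antisymm this (abs_nonneg _)))

/-- With `R` the kernel left after removing the atom, `ε ∑ₖ δ_o Rᵏ` is an invariant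
distribution. -/
theorem exists_invariant_of_le_atom [IsMarkovKernel K] (hε : 0 < ε)
    (h : ∀ x, (ε : ℝ≥0∞) ≤ K x {o}) :
    ∃ ν : Measure S, IsProbabilityMeasure ν ∧ ν.bind K = ν := by
  set R := removeAtom K ε o with hR
  let m : ℕ → Measure S := fun k =>
    Nat.rec ((ε : ℝ≥0∞) • Measure.dirac o) (fun _ ρ => ρ.bind R) k
  have hm0 : m 0 = (ε : ℝ≥0∞) • Measure.dirac o := rfl
  have hmS : ∀ k, m (k + 1) = (m k).bind R := fun _ => rfl
  have hmass : ∀ k, m k Set.univ = ε * (1 - ε) ^ k := by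
    intro k
    induction k with
    | zero => simp [hm0]
    | succ k ih =>
      rw [hmS, Measure.bind_apply MeasurableSet.univ R.aemeasurable]
      simp_rw [hR, removeAtom_univ h]
      rw [lintegral_const, ih]
      ring
  have hε1 : (ε : ℝ≥0∞) ≤ 1 := by exact_mod_cast le_one_of_le_atom h
  have hsum : Measure.sum m Set.univ = 1 := by
    rw [Measure.sum_apply _ MeasurableSet.univ]
    simp_rw [hmass]
    rw [ENNReal.tsum_mul_left, ENNReal.tsum_geometric,
      ENNReal.sub_sub_cancel ENNReal.one_ne_top hε1]
    exact ENNReal.mul_inv_cancel (by exact_mod_cast hε.ne') ENNReal.coe_ne_top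
  refine ⟨Measure.sum m, ⟨hsum⟩, ?_⟩
  ext A hA
  rw [Measure.bind_apply hA K.aemeasurable]
  have h1 : ∀ x, K x A = R x A + ((ε : ℝ≥0∞) • Measure.dirac o) A := fun x => by
    rw [← removeAtom_add h x]; rfl
  simp_rw [h1]
  rw [lintegral_add_right _ measurable_const, lintegral_const, hsum, mul_one,
    lintegral_sum_measure, Measure.sum_apply _ hA,
    tsum_eq_zero_add' (f := fun k => m k A) ENNReal.summable, add_comm, hm0]
  congr 1
  exact tsum_congr fun k => by rw [hmS, Measure.bind_apply hA R.aemeasurable]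

/-- A chain that reaches `o` in exactly `n` steps with probability at least `ε > 0`, whatever its
initial state, has exactly one invariant distribution. -/
theorem existsUnique_invariant_of_pow_le_atom (Q : Kernel S S) [IsMarkovKernel Q] (n : ℕ)
    (hε : 0 < ε) (h : ∀ x, (ε : ℝ≥0∞) ≤ (Q ^ n) x {o}) :
    ∃ ν : ProbabilityMeasure S, (ν : Measure S).bind Q = ν ∧
      ∀ μ : ProbabilityMeasure S, (μ : Measure S).bind Q = μ → μ = ν := by
  obtain ⟨ν, hν, hinv⟩ := exists_invariant_of_le_atom hε h
  refine ⟨⟨ν, hν⟩, ?_, fun μ hμ => Subtype.ext ?_⟩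
  swap
  · change (μ : Measure S) = ν
    exact eq_of_invariant_of_le_atom hε h (invariant_pow hμ n) hinv
  -- `ν Q` is invariant under `Qⁿ` as well, hence equal to `ν`.
  change ν.bind Q = ν
  refine eq_of_invariant_of_le_atom (μ := ν.bind Q) hε h ?_ hinv
  have h1 : (ν.bind Q).bind (Q ^ n : Kernel S S) = ν.bind (Q ^ (n + 1) : Kernel S S) := by
    rw [pow_succ]
    exact Measure.comp_assoc (κ := Q) (η := Q ^ n)
  have h2 : (ν.bind (Q ^ n : Kernel S S)).bind Q = ν.bind (Q ^ (n + 1) : Kernel S S) := by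
    rw [pow_succ']
    exact Measure.comp_assoc (κ := Q ^ n) (η := Q)
  rw [h1, ← h2, hinv]

end Doeblin

/-! ### Chains with finitely many possible transitions from every state -/

section JumpChain

theorem sum_div_le_one {S J : Type*} [Fintype J] {c : ℝ} {r : J → S → ℝ} (hc : 0 < c)
    (hsum : ∀ x, ∑ j, r j x ≤ c) (x : S) : ∑ j, r j x / c ≤ 1 := by
  rw [← Finset.sum_div, div_le_one hc]
  exact hsum x

variable {S : Type*} [MeasurableSpace S] [DiscreteMeasurableSpace S] [Countable S]
  {J : Type*} [Fintype J]

/-- The chain that from `x` moves to `T j x` with probability `r j x / c`, for each `j`, and stays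
put otherwise. -/
def jumpChain (c : ℝ) (r : J → S → ℝ) (T : J → S → S) : Kernel S S :=
  Kernel.ofFunOfCountable fun x =>
    ∑ j, ENNReal.ofReal (r j x / c) • Measure.dirac (T j x)
      + ENNReal.ofReal (1 - ∑ j, r j x / c) • Measure.dirac x

variable {c : ℝ} {r : J → S → ℝ} {T : J → S → S}

theorem jumpChain_apply (x : S) : jumpChain c r T x =
    ∑ j, ENNReal.ofReal (r j x / c) • Measure.dirac (T j x)
      + ENNReal.ofReal (1 - ∑ j, r j x / c) • Measure.dirac x := rfl

theorem isMarkovKernel_jumpChain (hc : 0 < c) (hr : ∀ j x, 0 ≤ r j x)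
    (hsum : ∀ x, ∑ j, r j x ≤ c) : IsMarkovKernel (jumpChain c r T) := by
  refine ⟨fun x => ⟨?_⟩⟩
  rw [jumpChain_apply]
  simp only [Measure.add_apply, Measure.finsetSum_apply, Measure.smul_apply, measure_univ,
    smul_eq_mul, mul_one]
  rw [← ENNReal.ofReal_sum_of_nonneg fun j _ => div_nonneg (hr j x) hc.le,
    ← ENNReal.ofReal_add (Finset.sum_nonneg fun j _ => div_nonneg (hr j x) hc.le)
      (sub_nonneg.2 (sum_div_le_one hc hsum x))]
  simp

/-- Uniformization at a rate `c` that dominates the total jump rate of every state. -/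
theorem isUniformization_jumpChain (hc : 0 < c) (hr : ∀ j x, 0 ≤ r j x)
    (hsum : ∀ x, ∑ j, r j x ≤ c) {L : (S → ℝ) → S → ℝ}
    (hL : ∀ f x, L f x = ∑ j, r j x * (f (T j x) - f x)) :
    IsUniformization L c.toNNReal (jumpChain c r T) := by
  intro f ⟨C, hC⟩ x
  have hfin : ∀ (w : ℝ) (y : S),
      IsFiniteMeasure (ENNReal.ofReal w • (Measure.dirac y : Measure S)) := fun w y =>
    inferInstanceAs (IsFiniteMeasure (w.toNNReal • (Measure.dirac y : Measure S)))
  have hint : ∀ (w : ℝ) (y : S), 0 ≤ w →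
      ∫ z, f z ∂(ENNReal.ofReal w • (Measure.dirac y : Measure S)) = w * f y := fun w y hw => by
    rw [integral_smul_measure, integral_dirac, ENNReal.toReal_ofReal hw, smul_eq_mul]
  rw [jumpChain_apply, integral_add_measure (integrable_of_forall_abs_le hC)
    (integrable_of_forall_abs_le hC), integral_finsetSum_measure
    fun j _ => integrable_of_forall_abs_le hC,
    hint _ _ (sub_nonneg.2 (sum_div_le_one hc hsum x)),
    Finset.sum_congr rfl fun j _ => hint _ (T j x) (div_nonneg (hr j x) hc.le), hL,
    Real.coe_toNNReal _ hc.le, sub_mul, one_mul, add_sub_assoc, sub_sub_cancel_left,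
    Finset.sum_mul, ← sub_eq_add_neg, ← Finset.sum_sub_distrib, Finset.mul_sum]
  refine Finset.sum_congr rfl fun j _ => ?_
  field_simp

theorem le_jumpChain_apply_jump (j : J) (x : S) :
    ENNReal.ofReal (r j x / c) ≤ jumpChain c r T x {T j x} := by
  rw [jumpChain_apply, Measure.add_apply, Measure.finsetSum_apply]
  refine le_trans ?_ le_self_add
  refine le_trans ?_ (Finset.single_le_sum (f := fun j' =>
    (ENNReal.ofReal (r j' x / c) • Measure.dirac (T j' x)) {T j x}) (fun _ _ => zero_le)
    (Finset.mem_univ j))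
  simp

theorem le_jumpChain_apply_self (x : S) :
    ENNReal.ofReal (1 - ∑ j, r j x / c) ≤ jumpChain c r T x {x} := by
  rw [jumpChain_apply, Measure.add_apply]
  refine le_trans ?_ le_add_self
  simp

theorem mul_le_pow_succ_apply {Q : Kernel S S} (n : ℕ) (x y : S) (A : Set S) :
    Q x {y} * (Q ^ n) y A ≤ (Q ^ (n + 1)) x A := by
  rw [add_comm, Kernel.pow_add_apply_eq_lintegral Q 1 n x MeasurableSet.of_discrete, pow_one]
  refine le_trans (le_of_eq ?_) (setLIntegral_le_lintegral {y} _)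
  rw [lintegral_singleton, mul_comm]

end JumpChain

/-! ### Configurations representing an empirical measure -/

section Configuration

variable {N : ℕ}

/-- The configuration `x` has empirical measure `ξ`. -/
def IsConfig (ξ : M1N N) (x : Fin N → ℕ) : Prop :=
  ((ξ : M1) : Measure ℕ) = (N : ℝ≥0∞)⁻¹ • ∑ i, Measure.dirac (x i)

/-- A choice of a configuration with empirical measure `ξ`. -/
def config (ξ : M1N N) : Fin N → ℕ := ξ.2.choose

theorem isConfig_config (ξ : M1N N) : IsConfig ξ (config ξ) := ξ.2.choose_spec

theorem IsConfig.jump {ξ : M1N N} {x : Fin N → ℕ} (hx : IsConfig ξ x) (i : Fin N) (z' : ℕ) :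
    IsConfig (jump N ξ (x i) z') (Function.update x i z') := jump_eq hx i z'

theorem IsConfig.unique {ξ η : M1N N} {x : Fin N → ℕ} (hξ : IsConfig ξ x) (hη : IsConfig η x) :
    ξ = η :=
  Subtype.ext (Subtype.ext (hξ.trans hη.symm))

instance : Countable (M1N N) :=
  Function.Injective.countable (f := config) fun ξ η h =>
    (isConfig_config ξ).unique (h ▸ isConfig_config η)

instance : MeasurableSingletonClass (M1N N) where
  measurableSet_singleton ξ := by
    have : ({ξ} : Set (M1N N)) = ⋂ z : ℕ, (fun η : M1N N => ((η : M1) : Measure ℕ) {z}) ⁻¹'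
        {((ξ : M1) : Measure ℕ) {z}} := by
      ext η
      simp only [Set.mem_singleton_iff, Set.mem_iInter, Set.mem_preimage]
      refine ⟨fun h z => by rw [h], fun h => Subtype.ext (Subtype.ext ?_)⟩
      exact Measure.ext_of_singleton h
    rw [this]
    refine MeasurableSet.iInter fun z => ?_
    refine measurableSet_preimage ?_ (measurableSet_singleton _)
    exact (Measure.measurable_coe (measurableSet_singleton z)).comp
      (measurable_subtype_coe.comp measurable_subtype_coe)

theorem IsConfig.sum_eq {ξ : M1N N} {x : Fin N → ℕ} (hx : IsConfig ξ x) (g : ℕ → ℝ) :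
    ∑ i, g (x i) = N * ∫ z, g z ∂((ξ : M1) : Measure ℕ) := by
  rw [show ((ξ : M1) : Measure ℕ) = _ from hx, integral_smul_measure,
    integral_finsetSum_measure fun i _ => integrable_dirac (by simp)]
  simp only [integral_dirac, smul_eq_mul, ENNReal.toReal_inv, ENNReal.toReal_natCast]
  rcases Nat.eq_zero_or_pos N with rfl | hN
  · simp
  · field_simp

theorem IsConfig.lintegral_eq {ξ : M1N N} {x : Fin N → ℕ} (hx : IsConfig ξ x) (g : ℕ → ℝ≥0∞) :
    ∫⁻ z, g z ∂((ξ : M1) : Measure ℕ) = (N : ℝ≥0∞)⁻¹ * ∑ i, g (x i) := by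
  rw [show ((ξ : M1) : Measure ℕ) = _ from hx, lintegral_smul_measure, lintegral_finsetSum_measure]
  simp

theorem IsConfig.sum_config {ξ : M1N N} {x : Fin N → ℕ} (hx : IsConfig ξ x) (g : ℕ → ℝ) :
    ∑ i, g (config ξ i) = ∑ i, g (x i) := by
  rw [hx.sum_eq, (isConfig_config ξ).sum_eq]

/-- Products over the particles depend on the empirical measure only: their logarithm is `N` times
an integral. -/
theorem IsConfig.prod_config {ξ : M1N N} {x : Fin N → ℕ} (hx : IsConfig ξ x) {g : ℕ → ℝ}
    (hg : ∀ z, 0 < g z) : ∏ i, g (config ξ i) = ∏ i, g (x i) := by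
  have h : ∀ y : Fin N → ℕ, ∏ i, g (y i) = Real.exp (∑ i, Real.log (g (y i))) := fun y => by
    rw [Real.exp_sum]
    exact Finset.prod_congr rfl fun i _ => (Real.exp_log (hg _)).symm
  rw [h, h, hx.sum_config fun z => Real.log (g z)]

theorem IsConfig.real_singleton {ξ : M1N N} {x : Fin N → ℕ} (hx : IsConfig ξ x) (z : ℕ) :
    (N : ℝ) * ((ξ : M1) : Measure ℕ).real {z} = ∑ i, if x i = z then (1 : ℝ) else 0 := by
  have h := hx.sum_eq (({z} : Set ℕ).indicator 1)
  rw [integral_indicator_one (measurableSet_singleton z)] at h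
  rw [← h]
  exact Finset.sum_congr rfl fun i _ => by simp [Set.indicator_apply]

/-- The empirical measure of a configuration. -/
def ofConfig (hN : 0 < N) (x : Fin N → ℕ) : M1N N :=
  ⟨⟨(N : ℝ≥0∞)⁻¹ • ∑ i, Measure.dirac (x i), ⟨by
    simp [ENNReal.inv_mul_cancel (Nat.cast_ne_zero.2 hN.ne') (ENNReal.natCast_ne_top N)]⟩⟩, x, rfl⟩

theorem isConfig_ofConfig (hN : 0 < N) (x : Fin N → ℕ) : IsConfig (ofConfig hN x) x := rfl

end Configuration

/-! ### The generator in terms of particles -/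

section Generator

variable {N : ℕ} {E : Set (ℕ × ℕ)} {lam : ℕ → ℕ → M1 → ℝ}

/-- The rate of the transition `z → 0`; there is no such transition for `z = 0`. -/
def backRate (lam : ℕ → ℕ → M1 → ℝ) (z : ℕ) (ξ : M1) : ℝ :=
  if z = 0 then 0 else lam z 0 ξ

/-- The edges starting at `z` are `(z, z + 1)` and, unless `z = 0`, `(z, 0)`. -/
theorem hasSum_edges (hE : AssumptionA1 E) (z : ℕ) (g : ℕ → ℕ → ℝ) :
    HasSum (fun e : E => if z = e.1.1 then g e.1.1 e.1.2 else 0)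
      (g z (z + 1) + if z = 0 then 0 else g z 0) := by
  classical
  subst hE
  let e₁ : ↥({e | ∃ z : ℕ, e = (z, z + 1)} ∪ {e | ∃ z : ℕ, z ≠ 0 ∧ e = (z, 0)} : Set (ℕ × ℕ)) :=
    ⟨(z, z + 1), Or.inl ⟨z, rfl⟩⟩
  by_cases hz : z = 0
  · have h := hasSum_sum_of_ne_finset_zero (L := .unconditional _) (s := {e₁}) (f := fun e :
      ↥({e | ∃ z : ℕ, e = (z, z + 1)} ∪ {e | ∃ z : ℕ, z ≠ 0 ∧ e = (z, 0)} : Set (ℕ × ℕ)) =>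
      if z = e.1.1 then g e.1.1 e.1.2 else 0) ?_
    · simpa [e₁, hz] using h
    · rintro ⟨e, ⟨y, rfl⟩ | ⟨y, hy, rfl⟩⟩ he
      · exact if_neg fun h => he (by simp [e₁, show z = y from h])
      · exact if_neg fun h => hy (h.symm.trans hz)
  · let e₀ : ↥({e | ∃ z : ℕ, e = (z, z + 1)} ∪ {e | ∃ z : ℕ, z ≠ 0 ∧ e = (z, 0)} :
        Set (ℕ × ℕ)) := ⟨(z, 0), Or.inr ⟨z, hz, rfl⟩⟩
    have hne : e₁ ≠ e₀ := fun h => by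
      simpa using congrArg (fun e => e.1.2) h
    have h := hasSum_sum_of_ne_finset_zero (L := .unconditional _) (s := {e₁, e₀}) (f := fun e :
      ↥({e | ∃ z : ℕ, e = (z, z + 1)} ∪ {e | ∃ z : ℕ, z ≠ 0 ∧ e = (z, 0)} : Set (ℕ × ℕ)) =>
      if z = e.1.1 then g e.1.1 e.1.2 else 0) ?_
    · rw [Finset.sum_pair hne] at h
      simpa [e₁, e₀, hz] using h
    · rintro ⟨e, ⟨y, rfl⟩ | ⟨y, hy, rfl⟩⟩ he
      · exact if_neg fun h => he (by simp [e₁, show z = y from h])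
      · exact if_neg fun h => he (by simp [e₀, show z = y from h])

/-- Since `N ξ{z}` is the number of particles at `z`, the generator is a sum over particles. -/
theorem generator_eq_sum (hE : AssumptionA1 E) (f : M1N N → ℝ) {ξ : M1N N} {x : Fin N → ℕ}
    (hx : IsConfig ξ x) :
    generator E lam N f ξ = ∑ i, (lam (x i) (x i + 1) ξ * (f (jump N ξ (x i) (x i + 1)) - f ξ)
      + backRate lam (x i) ξ * (f (jump N ξ (x i) 0) - f ξ)) := by
  have h := hasSum_sum fun i (_ : i ∈ (Finset.univ : Finset (Fin N))) =>
    hasSum_edges hE (x i) fun z z' => lam z z' ξ * (f (jump N ξ z z') - f ξ)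
  refine ((tsum_congr fun e => ?_).trans h.tsum_eq).trans (Finset.sum_congr rfl fun i _ => ?_)
  · rw [hx.real_singleton, mul_assoc, Finset.sum_mul]
    exact Finset.sum_congr rfl fun i _ => by split_ifs <;> simp
  · unfold backRate
    split_ifs <;> simp

end Generator

/-! ### The embedded chain of the particle system -/

section ParticleChain

variable {N : ℕ} {E : Set (ℕ × ℕ)} {lam : ℕ → ℕ → M1 → ℝ} {lo hi : ℝ}

theorem AssumptionA2.forward_nonneg (h : AssumptionA2 lo hi lam) (hlo : 0 < lo) (z : ℕ) (ξ : M1) :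
    0 ≤ lam z (z + 1) ξ :=
  le_trans (by positivity) ((h ξ).1 z).1

theorem AssumptionA2.forward_le (h : AssumptionA2 lo hi lam) (hhi : 0 < hi) (z : ℕ) (ξ : M1) :
    lam z (z + 1) ξ ≤ hi :=
  ((h ξ).1 z).2.trans (div_le_self hhi.le (by linarith [(Nat.cast_nonneg z : (0 : ℝ) ≤ z)]))

theorem AssumptionA2.backRate_nonneg (h : AssumptionA2 lo hi lam) (hlo : 0 < lo) (z : ℕ) (ξ : M1) :
    0 ≤ backRate lam z ξ := by
  unfold backRate
  split_ifs with hz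
  · exact le_rfl
  · exact hlo.le.trans ((h ξ).2 z hz).1

theorem AssumptionA2.backRate_le (h : AssumptionA2 lo hi lam) (hhi : 0 < hi) (z : ℕ) (ξ : M1) :
    backRate lam z ξ ≤ hi := by
  unfold backRate
  split_ifs with hz
  · exact hhi.le
  · exact ((h ξ).2 z hz).2

/-- The rates of the transitions out of `ξ`: the first copy of `Fin N` indexes the forward moves
of the particles, the second one their moves to `0`. -/
def particleRate (lam : ℕ → ℕ → M1 → ℝ) : Fin N ⊕ Fin N → M1N N → ℝ
  | .inl i, ξ => lam (config ξ i) (config ξ i + 1) ξ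
  | .inr i, ξ => backRate lam (config ξ i) ξ

/-- The targets of the transitions whose rates are given by `particleRate`. -/
def particleTarget : Fin N ⊕ Fin N → M1N N → M1N N
  | .inl i, ξ => jump N ξ (config ξ i) (config ξ i + 1)
  | .inr i, ξ => jump N ξ (config ξ i) 0

/-- The discrete-time chain whose uniformization at rate `2 N hi + lo` is the particle system. The
total jump rate is at most `2 N hi`; the additional `lo` makes the chain hold in each state with
probability at least `lo / (2 N hi + lo)`. -/
def particleChain (N : ℕ) (lam : ℕ → ℕ → M1 → ℝ) (lo hi : ℝ) : Kernel (M1N N) (M1N N) :=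
  jumpChain (2 * N * hi + lo) (particleRate lam) particleTarget

theorem particleRate_nonneg (h : AssumptionA2 lo hi lam) (hlo : 0 < lo) (j : Fin N ⊕ Fin N)
    (ξ : M1N N) : 0 ≤ particleRate lam j ξ := by
  rcases j with i | i
  · exact h.forward_nonneg hlo _ _
  · exact h.backRate_nonneg hlo _ _

theorem sum_particleRate_le (h : AssumptionA2 lo hi lam) (hhi : 0 < hi) (ξ : M1N N) :
    ∑ j, particleRate lam j ξ ≤ 2 * N * hi := by
  have : ∀ j : Fin N ⊕ Fin N, particleRate lam j ξ ≤ hi := by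
    rintro (i | i)
    · exact h.forward_le hhi _ _
    · exact h.backRate_le hhi _ _
  refine (Finset.sum_le_sum fun j _ => this j).trans_eq ?_
  rw [Finset.sum_const, Finset.card_univ, Fintype.card_sum, Fintype.card_fin, nsmul_eq_mul]
  push_cast
  ring

theorem isMarkovKernel_particleChain (h : AssumptionA2 lo hi lam) (hlo : 0 < lo) (hhi : 0 < hi) :
    IsMarkovKernel (particleChain N lam lo hi) :=
  isMarkovKernel_jumpChain (by positivity) (particleRate_nonneg h hlo) fun ξ =>
    (sum_particleRate_le h hhi ξ).trans (by linarith)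

theorem isUniformization_generator (hE : AssumptionA1 E) (h : AssumptionA2 lo hi lam)
    (hlo : 0 < lo) (hhi : 0 < hi) :
    IsUniformization (generator E lam N) (2 * N * hi + lo).toNNReal
      (particleChain N lam lo hi) :=
  isUniformization_jumpChain (by positivity) (particleRate_nonneg h hlo)
    (fun ξ => (sum_particleRate_le h hhi ξ).trans (by linarith)) fun f ξ => by
      rw [generator_eq_sum hE f (isConfig_config ξ), Fintype.sum_sum_type,
        ← Finset.sum_add_distrib]
      rfl

/-- The number of particles that are not at `0`. -/
def numNonzero (x : Fin N → ℕ) : ℕ := (Finset.univ.filter fun i => x i ≠ 0).card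

theorem IsConfig.numNonzero_config {ξ : M1N N} {x : Fin N → ℕ} (hx : IsConfig ξ x) :
    numNonzero (config ξ) = numNonzero x := by
  have h := hx.sum_config fun z => if z ≠ 0 then 1 else 0
  simp only [Finset.sum_boole] at h
  exact_mod_cast h

theorem numNonzero_update_lt {x : Fin N → ℕ} {i : Fin N} (hi : x i ≠ 0) :
    numNonzero (Function.update x i 0) < numNonzero x := by
  refine Finset.card_lt_card (Finset.ssubset_iff_subset_ne.2 ⟨fun j hj => ?_, fun h => ?_⟩)
  · rw [Finset.mem_filter] at hj ⊢
    refine ⟨Finset.mem_univ _, fun h0 => hj.2 ?_⟩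
    rcases eq_or_ne j i with rfl | hji
    · simp
    · rw [Function.update_of_ne hji, h0]
  · have : i ∈ Finset.univ.filter fun i => x i ≠ 0 := by simp [hi]
    rw [← h] at this
    simp at this

/-- Whatever the other particles do, a particle away from `0` returns there at rate at least `lo`;
so the chain collects all particles at `0` within `n` steps, if at most `n` are elsewhere. -/
theorem pow_le_particleChain_pow (h : AssumptionA2 lo hi lam) (hlo : 0 < lo) (hhi : 0 < hi)
    (hN : 0 < N) (n : ℕ) (ξ : M1N N) (hξ : numNonzero (config ξ) ≤ n) :
    ENNReal.ofReal (lo / (2 * N * hi + lo)) ^ n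
      ≤ (particleChain N lam lo hi ^ n) ξ {ofConfig hN fun _ => 0} := by
  have hc : 0 < 2 * N * hi + lo := by positivity
  have horigin : ∀ η : M1N N, (∀ i, config η i = 0) → η = ofConfig hN fun _ => 0 :=
    fun η hη => IsConfig.unique (isConfig_config η)
      ((funext hη : config η = fun _ => 0) ▸ isConfig_ofConfig hN _)
  induction n generalizing ξ with
  | zero =>
    have h0 : ξ = ofConfig hN fun _ => 0 := horigin ξ fun i => by
      by_contra hi
      have : i ∈ Finset.univ.filter fun i => config ξ i ≠ 0 := by simp [hi]
      exact absurd (Finset.card_pos.2 ⟨i, this⟩) (by unfold numNonzero at hξ; omega)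
    change _ ≤ (Kernel.id : Kernel (M1N N) (M1N N)) ξ _
    rw [Kernel.id_apply, ← h0]
    simp
  | succ n ih =>
    by_cases hall : ∀ i, config ξ i = 0
    · have h0 : numNonzero (config ξ) ≤ n := by simp [numNonzero, hall]
      refine le_trans ?_ (mul_le_pow_succ_apply n ξ ξ _)
      rw [pow_succ']
      refine mul_le_mul' (le_trans (ENNReal.ofReal_le_ofReal ?_) (le_jumpChain_apply_self ξ))
        (ih ξ h0)
      rw [← Finset.sum_div, div_le_iff₀ hc, sub_mul, one_mul, div_mul_cancel₀ _ hc.ne']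
      linarith [sum_particleRate_le h hhi ξ]
    · push Not at hall
      obtain ⟨i, hi⟩ := hall
      have hcfg := (isConfig_config ξ).jump i 0
      have h0 : numNonzero (config (particleTarget (.inr i) ξ)) ≤ n := by
        have h1 := numNonzero_update_lt hi
        rw [← hcfg.numNonzero_config] at h1
        exact Nat.lt_succ_iff.1 (h1.trans_le hξ)
      refine le_trans ?_ (mul_le_pow_succ_apply n ξ (particleTarget (.inr i) ξ) _)
      rw [pow_succ']
      refine mul_le_mul' (le_trans (ENNReal.ofReal_le_ofReal ?_)
        (le_jumpChain_apply_jump (Sum.inr i) ξ)) (ih _ h0)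
      have : lo ≤ particleRate lam (.inr i) ξ := by
        simp only [particleRate, backRate, if_neg hi]
        exact ((h ξ).2 _ hi).1
      gcongr

theorem existsUnique_invariant_particleChain (h : AssumptionA2 lo hi lam) (hlo : 0 < lo)
    (hhi : 0 < hi) (hN : 0 < N) :
    ∃ ν : ProbabilityMeasure (M1N N),
      (ν : Measure (M1N N)).bind (particleChain N lam lo hi) = ν ∧
      ∀ μ : ProbabilityMeasure (M1N N),
        (μ : Measure (M1N N)).bind (particleChain N lam lo hi) = μ → μ = ν := by
  have := isMarkovKernel_particleChain (N := N) h hlo hhi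
  refine existsUnique_invariant_of_pow_le_atom (ε := (lo / (2 * N * hi + lo)).toNNReal ^ N)
    (o := ofConfig hN fun _ => 0) _ N (by positivity) fun ξ => ?_
  rw [ENNReal.coe_pow]
  refine pow_le_particleChain_pow h hlo hhi hN N ξ ?_
  exact (Finset.card_le_univ _).trans_eq (Fintype.card_fin N)

end ParticleChain

/-! ### Exponential moments of an invariant distribution -/

section Moment

variable {N : ℕ} {E : Set (ℕ × ℕ)} {lam : ℕ → ℕ → M1 → ℝ}

/-- The function `∏ᵢ (1 + s u(xᵢ))` of the empirical measure of `x`. -/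
def prodFn (u : ℕ → ℝ) (s : ℝ) (ξ : M1N N) : ℝ := ∏ i, (1 + s * u (config ξ i))

/-- The derivative of `prodFn u s` in `s`. -/
def prodFnDeriv (u : ℕ → ℝ) (s : ℝ) (ξ : M1N N) : ℝ :=
  ∑ i, (∏ j ∈ Finset.univ.erase i, (1 + s * u (config ξ j))) * u (config ξ i)

theorem hasDerivAt_prodFn (u : ℕ → ℝ) (s : ℝ) (ξ : M1N N) :
    HasDerivAt (fun s => prodFn u s ξ) (prodFnDeriv u s ξ) s := by
  have := HasDerivAt.fun_finsetProd (u := Finset.univ) (x := s)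
    (f := fun i s => 1 + s * u (config ξ i)) (f' := fun i => u (config ξ i)) fun i _ => by
      simpa using ((hasDerivAt_id s).mul_const (u (config ξ i))).const_add 1
  simpa [prodFn, prodFnDeriv] using this

variable {u : ℕ → ℝ} {B : ℝ}

theorem abs_prod_le (hu : ∀ z, 0 ≤ u z) (huB : ∀ z, u z ≤ B) {s : ℝ} (hs : |s| ≤ 2)
    (x : Fin N → ℕ) (I : Finset (Fin N)) :
    |∏ i ∈ I, (1 + s * u (x i))| ≤ (1 + 2 * B) ^ N := by
  have hB : 0 ≤ B := (hu 0).trans (huB 0)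
  rw [Finset.abs_prod]
  have h1 : ∀ i ∈ I, |1 + s * u (x i)| ≤ 1 + 2 * B := fun i _ => by
    refine (abs_add_le _ _).trans ?_
    rw [abs_one, abs_mul, abs_of_nonneg (hu _)]
    exact add_le_add_right (mul_le_mul hs (huB _) (hu _) zero_le_two) 1
  refine (Finset.prod_le_prod (fun i _ => abs_nonneg _) h1).trans ?_
  rw [Finset.prod_const]
  refine pow_le_pow_right₀ (by linarith) ?_
  exact (Finset.card_le_univ _).trans_eq (Fintype.card_fin N)

theorem abs_prodFn_le (hu : ∀ z, 0 ≤ u z) (huB : ∀ z, u z ≤ B) {s : ℝ} (hs : |s| ≤ 2)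
    (ξ : M1N N) : |prodFn u s ξ| ≤ (1 + 2 * B) ^ N :=
  abs_prod_le hu huB hs _ _

theorem abs_prodFnDeriv_le (hu : ∀ z, 0 ≤ u z) (huB : ∀ z, u z ≤ B) {s : ℝ} (hs : |s| ≤ 2)
    (ξ : M1N N) : |prodFnDeriv u s ξ| ≤ N * ((1 + 2 * B) ^ N * B) := by
  have hB : 0 ≤ B := (hu 0).trans (huB 0)
  refine (Finset.abs_sum_le_sum_abs _ _).trans ?_
  have h1 : ∀ i : Fin N, |(∏ j ∈ Finset.univ.erase i, (1 + s * u (config ξ j))) * u (config ξ i)|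
      ≤ (1 + 2 * B) ^ N * B := fun i => by
    rw [abs_mul, abs_of_nonneg (hu _)]
    exact mul_le_mul (abs_prod_le hu huB hs _ _) (huB _) (hu _) (by positivity)
  refine (Finset.sum_le_sum fun i _ => h1 i).trans_eq ?_
  simp

theorem prodFn_jump_sub (hu : ∀ z, 0 ≤ u z) {s : ℝ} (hs : 0 ≤ s) (ξ : M1N N) (i : Fin N)
    (z' : ℕ) : prodFn u s (jump N ξ (config ξ i) z') - prodFn u s ξ
      = s * (∏ j ∈ Finset.univ.erase i, (1 + s * u (config ξ j)))
        * (u z' - u (config ξ i)) := by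
  have hpos : ∀ z, 0 < 1 + s * u z := fun z => by have := mul_nonneg hs (hu z); linarith
  have h1 := ((isConfig_config ξ).jump i z').prod_config hpos
  unfold prodFn
  rw [h1, ← Finset.mul_prod_erase _ _ (Finset.mem_univ i),
    ← Finset.mul_prod_erase _ (fun j => 1 + s * u (config ξ j)) (Finset.mem_univ i),
    Function.update_self]
  have h2 : ∏ j ∈ Finset.univ.erase i, (1 + s * u (Function.update (config ξ) i z' j))
      = ∏ j ∈ Finset.univ.erase i, (1 + s * u (config ξ j)) :=
    Finset.prod_congr rfl fun j hj => by rw [Function.update_of_ne (Finset.ne_of_mem_erase hj)]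
  rw [h2]
  ring

/-- If each single particle obeys the drift inequality `A u ≤ a (1 - u)`, whatever the empirical
measure, then the generator applied to `∏ᵢ (1 + s u(xᵢ))` is at most `s a` times `N` times this
product minus its derivative in `s`. -/
theorem generator_prodFn_le (hE : AssumptionA1 E) (hu : ∀ z, 0 ≤ u z) {a : ℝ} (ha : 0 ≤ a)
    (hdrift : ∀ (ξ : M1) (z : ℕ),
      lam z (z + 1) ξ * (u (z + 1) - u z) + backRate lam z ξ * (u 0 - u z) ≤ a * (1 - u z))
    {s : ℝ} (hs : 0 ≤ s) (ξ : M1N N) :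
    generator E lam N (prodFn u s) ξ ≤ s * a * (N * prodFn u s ξ - prodFnDeriv u s ξ) := by
  have hone : ∀ z, 1 ≤ 1 + s * u z := fun z => by have := mul_nonneg hs (hu z); linarith
  have hN : (N : ℝ) * prodFn u s ξ = ∑ _i : Fin N, prodFn u s ξ := by simp
  rw [generator_eq_sum hE _ (isConfig_config ξ), hN, prodFnDeriv, ← Finset.sum_sub_distrib,
    Finset.mul_sum]
  refine Finset.sum_le_sum fun i _ => ?_
  rw [prodFn_jump_sub hu hs, prodFn_jump_sub hu hs]
  set P := ∏ j ∈ Finset.univ.erase i, (1 + s * u (config ξ j)) with hP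
  have hP0 : 0 ≤ P := Finset.prod_nonneg fun j _ => zero_le_one.trans (hone _)
  have hPle : P ≤ prodFn u s ξ := by
    rw [prodFn, ← Finset.mul_prod_erase _ _ (Finset.mem_univ i)]
    exact le_mul_of_one_le_left hP0 (hone _)
  calc _ = s * P * (lam (config ξ i) (config ξ i + 1) ξ * (u (config ξ i + 1) - u (config ξ i))
        + backRate lam (config ξ i) ξ * (u 0 - u (config ξ i))) := by ring
    _ ≤ s * P * (a * (1 - u (config ξ i))) :=
        mul_le_mul_of_nonneg_left (hdrift _ _) (mul_nonneg hs hP0)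
    _ = s * a * (P - P * u (config ξ i)) := by ring
    _ ≤ s * a * (prodFn u s ξ - P * u (config ξ i)) :=
        mul_le_mul_of_nonneg_left (by linarith) (mul_nonneg hs ha)

/-- Integrating the drift inequality gives `G' ≤ N G` for `G s = ∫ ∏ᵢ (1 + s u(xᵢ)) dμ`, and
`G 0 = 1`. -/
theorem integral_prodFn_le_exp (hE : AssumptionA1 E) (hu : ∀ z, 0 ≤ u z) (huB : ∀ z, u z ≤ B)
    {a : ℝ} (ha : 0 < a)
    (hdrift : ∀ (ξ : M1) (z : ℕ),
      lam z (z + 1) ξ * (u (z + 1) - u z) + backRate lam z ξ * (u 0 - u z) ≤ a * (1 - u z))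
    (μ : Measure (M1N N)) [IsProbabilityMeasure μ]
    (hμ : ∀ f : M1N N → ℝ, (∃ C, ∀ ξ, |f ξ| ≤ C) →
      Integrable (generator E lam N f) μ ∧ ∫ ξ, generator E lam N f ξ ∂μ = 0) :
    ∫ ξ, prodFn u 1 ξ ∂μ ≤ Real.exp N := by
  set G : ℝ → ℝ := fun s => ∫ ξ, prodFn u s ξ ∂μ with hG
  have hint : ∀ s : ℝ, |s| ≤ 2 → Integrable (prodFn u s) μ := fun s hs =>
    integrable_of_forall_abs_le (abs_prodFn_le hu huB hs)
  have hint' : ∀ s : ℝ, |s| ≤ 2 → Integrable (prodFnDeriv u s) μ := fun s hs =>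
    integrable_of_forall_abs_le (abs_prodFnDeriv_le hu huB hs)
  have hderiv : ∀ s ∈ Set.Icc (0 : ℝ) 1, HasDerivAt G (∫ ξ, prodFnDeriv u s ξ ∂μ) s := by
    intro s hs
    have hs2 : |s| < 2 := by rw [abs_lt]; constructor <;> linarith [hs.1, hs.2]
    refine (hasDerivAt_integral_of_dominated_loc_of_deriv_le (F := fun s ξ => prodFn u s ξ)
      (F' := fun s ξ => prodFnDeriv u s ξ) (s := Metric.ball 0 2)
      (bound := fun _ => N * ((1 + 2 * B) ^ N * B))
      (Metric.isOpen_ball.mem_nhds (by simpa using hs2))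
      (Eventually.of_forall fun _ => Measurable.of_discrete.aestronglyMeasurable)
      (hint s hs2.le) Measurable.of_discrete.aestronglyMeasurable ?_ (integrable_const _) ?_).2
    · exact ae_of_all _ fun ξ t ht => abs_prodFnDeriv_le hu huB ((mem_ball_zero_iff.1 ht).le) ξ
    · exact ae_of_all _ fun ξ t _ => hasDerivAt_prodFn u t ξ
  have hle : ∀ s ∈ Set.Ioo (0 : ℝ) 1, ∫ ξ, prodFnDeriv u s ξ ∂μ ≤ N * G s := by
    intro s hs
    have hs2 : |s| ≤ 2 := by rw [abs_le]; constructor <;> linarith [hs.1, hs.2]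
    obtain ⟨hi, h0⟩ := hμ (prodFn u s) ⟨_, abs_prodFn_le hu huB hs2⟩
    have h1 := integral_mono hi (((hint s hs2).const_mul (N : ℝ)).sub (hint' s hs2)
      |>.const_mul (s * a)) (generator_prodFn_le hE hu ha.le hdrift hs.1.le)
    rw [h0] at h1
    simp only [Pi.sub_apply] at h1
    rw [integral_const_mul, integral_sub ((hint s hs2).const_mul _) (hint' s hs2),
      integral_const_mul] at h1
    have := nonneg_of_mul_nonneg_right h1 (mul_pos hs.1 ha)
    linarith
  have hH : ∀ s ∈ Set.Icc (0 : ℝ) 1, HasDerivAt (fun s => Real.exp (-(N * s)) * G s)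
      (Real.exp (-(N * s)) * ((∫ ξ, prodFnDeriv u s ξ ∂μ) - N * G s)) s := fun s hs => by
    have h1 : HasDerivAt (fun s : ℝ => Real.exp (-(N * s))) (Real.exp (-(N * s)) * -N) s := by
      simpa using (((hasDerivAt_id s).const_mul (N : ℝ)).neg).exp
    refine (h1.mul (hderiv s hs)).congr_deriv ?_
    ring
  have hanti : AntitoneOn (fun s => Real.exp (-(N * s)) * G s) (Set.Icc 0 1) := by
    refine antitoneOn_of_deriv_nonpos (convex_Icc 0 1)
      (fun s hs => (hH s hs).continuousAt.continuousWithinAt)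
      (fun s hs => (hH s (interior_subset hs)).differentiableAt.differentiableWithinAt)
      fun s hs => ?_
    rw [(hH s (interior_subset hs)).deriv]
    rw [interior_Icc] at hs
    exact mul_nonpos_of_nonneg_of_nonpos (Real.exp_pos _).le (by linarith [hle s hs])
  have h01 := hanti (Set.left_mem_Icc.2 zero_le_one) (Set.right_mem_Icc.2 zero_le_one) zero_le_one
  have hG0 : G 0 = 1 := by simp [hG, prodFn]
  simp only [hG0, mul_one, mul_zero, neg_zero, Real.exp_zero] at h01
  rwa [Real.exp_neg, inv_mul_le_iff₀ (Real.exp_pos _), mul_one] at h01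

end Moment

/-! ### The function `z log z` along the transitions -/

section Potential

/-- The function `z log z`. -/
def phi (z : ℕ) : ℝ := z * Real.log z

theorem phi_nonneg (z : ℕ) : 0 ≤ phi z :=
  mul_nonneg (Nat.cast_nonneg z) (Real.log_natCast_nonneg z)

theorem phi_mono : Monotone phi := by
  refine monotone_nat_of_le_succ fun z => ?_
  rcases Nat.eq_zero_or_pos z with rfl | hz
  · simp [phi]
  · unfold phi
    have : (0 : ℝ) < z := by exact_mod_cast hz
    have h1 := Real.log_natCast_nonneg z
    gcongr <;> simp

theorem phi_succ_sub_le (z : ℕ) : phi (z + 1) - phi z ≤ 1 + Real.log (z + 1) := by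
  unfold phi
  push_cast
  rcases Nat.eq_zero_or_pos z with rfl | hz
  · simp
  · have hz' : (0 : ℝ) < z := by exact_mod_cast hz
    have h1 : Real.log ((z + 1) / z) ≤ (z + 1) / z - 1 := Real.log_le_sub_one_of_pos (by positivity)
    rw [Real.log_div (by positivity) hz'.ne'] at h1
    have h2 := mul_le_mul_of_nonneg_left h1 hz'.le
    have h3 : (z : ℝ) * ((z + 1) / z - 1) = 1 := by field_simp; ring
    linarith

/-- By convexity, `exp (β L) ≤ 1 - β + β exp L`, used with `L = 1 + log (z + 1)`. -/
theorem exp_phi_succ_sub_le {β : ℝ} (hβ0 : 0 ≤ β) (hβ1 : β ≤ 1) (z : ℕ) :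
    Real.exp (β * (phi (z + 1) - phi z)) - 1 ≤ β * Real.exp 1 * (z + 1) := by
  have hL : Real.exp (1 + Real.log (z + 1)) = Real.exp 1 * (z + 1) := by
    rw [Real.exp_add, Real.exp_log (by positivity)]
  have h1 := convexOn_exp.2 (Set.mem_univ 0) (Set.mem_univ (1 + Real.log ((z : ℝ) + 1)))
    (sub_nonneg.2 hβ1) hβ0 (by ring)
  simp only [smul_eq_mul, mul_zero, zero_add, Real.exp_zero, mul_one, hL] at h1
  have h2 : Real.exp (β * (phi (z + 1) - phi z)) ≤ Real.exp (β * (1 + Real.log (z + 1))) :=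
    Real.exp_le_exp.2 (mul_le_mul_of_nonneg_left (phi_succ_sub_le z) hβ0)
  linarith

/-- The bounded function `exp (β φ(min z n)) - 1`, where `φ z = z log z`. -/
def truncExp (β : ℝ) (n z : ℕ) : ℝ := Real.exp (β * phi (min z n)) - 1

theorem truncExp_nonneg {β : ℝ} (hβ : 0 ≤ β) (n z : ℕ) : 0 ≤ truncExp β n z := by
  have := Real.one_le_exp (mul_nonneg hβ (phi_nonneg (min z n)))
  unfold truncExp
  linarith

theorem truncExp_le {β : ℝ} (hβ : 0 ≤ β) (n z : ℕ) : truncExp β n z ≤ truncExp β n n := by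
  unfold truncExp
  have := phi_mono (show min z n ≤ min n n by simp)
  gcongr

/-- The forward rate `hi / (z + 1)` compensates the growth factor of `exp (β z log z)`, which is
at most of order `z + 1`. -/
theorem truncExp_succ_sub_le {β hi b : ℝ} (hβ0 : 0 ≤ β) (hβ1 : β ≤ 1) (hhi : 0 ≤ hi)
    (hb : β * Real.exp 1 * hi ≤ b) (n z : ℕ) :
    hi / (z + 1) * (truncExp β n (z + 1) - truncExp β n z) ≤ b * (1 + truncExp β n z) := by
  have hb0 : 0 ≤ b := le_trans (by positivity) hb
  unfold truncExp
  rcases lt_or_ge z n with hz | hz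
  · rw [min_eq_left hz.le, min_eq_left (Nat.succ_le_of_lt hz)]
    have h1 : Real.exp (β * phi (z + 1)) - 1 - (Real.exp (β * phi z) - 1)
        = Real.exp (β * phi z) * (Real.exp (β * (phi (z + 1) - phi z)) - 1) := by
      rw [mul_sub, ← Real.exp_add]; ring_nf
    rw [h1, add_sub_cancel]
    calc _ ≤ hi / (z + 1) * (Real.exp (β * phi z) * (β * Real.exp 1 * (z + 1))) := by
          gcongr
          exact exp_phi_succ_sub_le hβ0 hβ1 z
      _ = β * Real.exp 1 * hi * Real.exp (β * phi z) := by field_simp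
      _ ≤ b * Real.exp (β * phi z) := by gcongr
  · rw [min_eq_right hz, min_eq_right (hz.trans (Nat.le_succ z)), sub_self, mul_zero,
      add_sub_cancel]
    positivity

theorem truncExp_drift {lo hi β : ℝ} {lam : ℕ → ℕ → M1 → ℝ} (h : AssumptionA2 lo hi lam)
    (hhi : 0 < hi) (hβ0 : 0 ≤ β) (hβ1 : β ≤ 1) (hβ : β * Real.exp 1 * hi ≤ lo / 2)
    (n : ℕ) (ξ : M1) (z : ℕ) :
    lam z (z + 1) ξ * (truncExp β n (z + 1) - truncExp β n z)
      + backRate lam z ξ * (truncExp β n 0 - truncExp β n z)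
      ≤ lo / 2 * (1 - truncExp β n z) := by
  have h0 : truncExp β n 0 = 0 := by simp [truncExp, phi]
  have hmono : 0 ≤ truncExp β n (z + 1) - truncExp β n z := by
    have := phi_mono (min_le_min_right n (Nat.le_succ z))
    unfold truncExp
    rw [sub_sub_sub_cancel_right, sub_nonneg]
    exact Real.exp_le_exp.2 (mul_le_mul_of_nonneg_left this hβ0)
  have h1 : lam z (z + 1) ξ * (truncExp β n (z + 1) - truncExp β n z)
      ≤ lo / 2 * (1 + truncExp β n z) :=
    (mul_le_mul_of_nonneg_right ((h ξ).1 z).2 hmono).trans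
      (truncExp_succ_sub_le hβ0 hβ1 hhi.le hβ n z)
  have h2 : backRate lam z ξ * (truncExp β n 0 - truncExp β n z) ≤ -(lo * truncExp β n z) := by
    rw [h0]
    unfold backRate
    split_ifs with hz
    · simp [hz, h0]
    · have := mul_le_mul_of_nonneg_right ((h ξ).2 z hz).1 (truncExp_nonneg hβ0 n z)
      linarith
  linarith

end Potential

/-! ### Compactness of the level sets -/

section Tightness

theorem mem_KM {M : ℝ} {ξ : M1} : ξ ∈ KM M ↔
    ∫⁻ z : ℕ, ENNReal.ofReal (phi z) ∂(ξ : Measure ℕ) ≤ ENNReal.ofReal M := Iff.rfl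

theorem measurableSet_KM (M : ℝ) : MeasurableSet (KM M) :=
  measurableSet_le ((Measure.measurable_lintegral Measurable.of_discrete).comp
    measurable_subtype_coe) measurable_const

/-- A bound on the integral of `z log z` makes `KM M` tight, and Prokhorov's theorem applies. -/
theorem isCompact_closure_KM (M : ℝ) : IsCompact (closure (KM M)) := by
  refine isCompact_closure_of_isTightMeasureSet
    (isTightMeasureSet_iff_exists_isCompact_measure_compl_le.2 fun ε hε => ?_)
  obtain ⟨n, hn⟩ := ENNReal.exists_nat_gt (ENNReal.div_ne_top 
    (ENNReal.ofReal_ne_top (r := M)) hε.ne')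
  -- From `z = 3` on, `1 ≤ log z` and hence `z ≤ φ z`.
  refine ⟨Set.Iio (max n 3), (Set.finite_Iio _).isCompact, ?_⟩
  rintro _ ⟨ξ, hξ, rfl⟩
  rw [mem_KM] at hξ
  have hsub : (Set.Iio (max n 3))ᶜ ⊆ {z : ℕ | (n : ℝ≥0∞) ≤ ENNReal.ofReal (phi z)} := by
    intro z hz
    rw [Set.mem_compl_iff, Set.mem_Iio, not_lt, max_le_iff] at hz
    have h3 : (3 : ℝ) ≤ z := by exact_mod_cast hz.2
    have h1 : 1 ≤ Real.log z := by
      rw [Real.le_log_iff_exp_le (by linarith)]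
      linarith [Real.exp_one_lt_d9]
    have h2 : (n : ℝ) ≤ phi z := by
      have : (n : ℝ) ≤ z := by exact_mod_cast hz.1
      unfold phi
      nlinarith
    rw [Set.mem_ofPred_eq, ← ENNReal.ofReal_natCast]
    exact ENNReal.ofReal_le_ofReal h2
  have h1 : (n : ℝ≥0∞) * (ξ : Measure ℕ) (Set.Iio (max n 3))ᶜ ≤ ENNReal.ofReal M :=
    (mul_le_mul_right (measure_mono hsub) _).trans
      ((mul_meas_ge_le_lintegral Measurable.of_discrete _).trans hξ)
  have hn0 : (n : ℝ≥0∞) ≠ 0 := (zero_le.trans_lt hn).ne'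
  have h2 : ENNReal.ofReal M ≤ n * ε := by
    rcases eq_or_ne ε ⊤ with rfl | hε'
    · rw [ENNReal.mul_top hn0]; exact le_top
    · exact (ENNReal.div_le_iff hε.ne' hε').1 hn.le
  exact (ENNReal.mul_le_mul_iff_right hn0 (ENNReal.natCast_ne_top n)).1 (h1.trans h2)

end Tightness

/-! ### The tail estimate -/

section Tail

variable {N : ℕ}

theorem prodFn_truncExp (β : ℝ) (n : ℕ) (ξ : M1N N) :
    prodFn (truncExp β n) 1 ξ = ∏ i, Real.exp (β * phi (min (config ξ i) n)) := by
  simp [prodFn, truncExp]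

/-- The exponential moments of the truncated functions pass to the limit by Fatou's lemma. -/
theorem lintegral_exp_phi_le {β : ℝ} {μ : Measure (M1N N)}
    {C : ℝ} (hβ : 0 ≤ β) [IsProbabilityMeasure μ]
    (hμ : ∀ n, ∫ ξ, prodFn (truncExp β n) 1 ξ ∂μ ≤ C) :
    ∫⁻ ξ, ENNReal.ofReal (∏ i, Real.exp (β * phi (config ξ i))) ∂μ ≤ ENNReal.ofReal C := by
  have h1 : ∀ ξ : M1N N, liminf (fun n => ENNReal.ofReal (prodFn (truncExp β n) 1 ξ)) atTop
      = ENNReal.ofReal (∏ i, Real.exp (β * phi (config ξ i))) := fun ξ => by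
    refine Tendsto.liminf_eq (tendsto_const_nhds.congr' ?_)
    filter_upwards [eventually_ge_atTop (∑ i, config ξ i)] with n hn
    rw [prodFn_truncExp]
    congr 1
    refine Finset.prod_congr rfl fun i _ => ?_
    rw [min_eq_left]
    exact (Finset.single_le_sum (fun _ _ => Nat.zero_le _) (Finset.mem_univ i)).trans hn
  simp_rw [← h1]
  refine (lintegral_liminf_le fun n => Measurable.of_discrete).trans ?_
  refine liminf_le_of_le (by isBoundedDefault) fun b hb => ?_
  obtain ⟨n, hn⟩ := hb.exists
  refine hn.trans ?_
  rw [← ofReal_integral_eq_lintegral_ofReal]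
  · exact ENNReal.ofReal_le_ofReal (hμ n)
  · exact integrable_of_forall_abs_le (abs_prodFn_le (truncExp_nonneg hβ n) (truncExp_le hβ n)
      (by norm_num))
  · refine ae_of_all _ fun ξ => ?_
    rw [prodFn_truncExp]
    exact Finset.prod_nonneg fun _ _ => (Real.exp_pos _).le

/-- Outside `KM M` the product of the `exp (β φ(xᵢ))` exceeds `exp (N M β)`, so Chebyshev's
inequality applies. -/
theorem map_compl_KM_le {β : ℝ} (hβ : 0 ≤ β) (hN : 0 < N) {μ : Measure (M1N N)}
    (hμ : ∫⁻ ξ, ENNReal.ofReal (∏ i, Real.exp (β * phi (config ξ i))) ∂μ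
      ≤ ENNReal.ofReal (Real.exp N)) (M : ℝ) :
    μ.map Subtype.val (KM M)ᶜ ≤ ENNReal.ofReal (Real.exp (-(N * (M * β - 1)))) := by
  rw [Measure.map_apply Measurable.of_discrete (measurableSet_KM M).compl]
  have hN' : (0 : ℝ) < N := by exact_mod_cast hN
  have hsub : (Subtype.val ⁻¹' (KM M)ᶜ : Set (M1N N)) ⊆
      {ξ | ENNReal.ofReal (Real.exp (N * M * β))
        ≤ ENNReal.ofReal (∏ i, Real.exp (β * phi (config ξ i)))} := by
    intro ξ hξ
    rw [Set.mem_preimage, Set.mem_compl_iff, mem_KM, not_le,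
      (isConfig_config ξ).lintegral_eq, ← ENNReal.ofReal_sum_of_nonneg fun i _ => phi_nonneg _,
      ← ENNReal.ofReal_natCast, ← ENNReal.ofReal_inv_of_pos hN',
      ← ENNReal.ofReal_mul (by positivity)] at hξ
    have h1 := (ENNReal.ofReal_lt_ofReal_iff'.1 hξ).1
    refine ENNReal.ofReal_le_ofReal ?_
    rw [← Real.exp_sum, ← Finset.mul_sum]
    refine Real.exp_le_exp.2 ?_
    rw [lt_inv_mul_iff₀ hN'] at h1
    nlinarith
  have h1 : ENNReal.ofReal (Real.exp (N * M * β)) * μ (Subtype.val ⁻¹' (KM M)ᶜ)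
      ≤ ENNReal.ofReal (Real.exp N) :=
    (mul_le_mul_right (measure_mono hsub) _).trans
      ((mul_meas_ge_le_lintegral Measurable.of_discrete _).trans hμ)
  rw [mul_comm, ← ENNReal.le_div_iff_mul_le (Or.inl (by positivity)) (Or.inl ENNReal.ofReal_ne_top),
    ← ENNReal.ofReal_div_of_pos (Real.exp_pos _), ← Real.exp_sub] at h1
  refine h1.trans_eq ?_
  congr 2
  ring

theorem exponentiallyTight_of_compl_KM_le {β : ℝ} (hβ : 0 < β) {μ : ℕ+ → Measure M1}
    (hμ : ∀ (N : ℕ+) (M : ℝ), 0 < M →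
      μ N (KM M)ᶜ ≤ ENNReal.ofReal (Real.exp (-((N : ℕ) * (M * β - 1))))) :
    ExponentiallyTight μ := by
  intro M hM
  -- The level is chosen to make the exponent `-N ((M + 1) / β * β - 1)` equal to `-N M`.
  refine ⟨closure (KM ((M + 1) / β)), isCompact_closure_KM _, ?_⟩
  refine limsup_le_of_le (by isBoundedDefault) (Eventually.of_forall fun N => ?_)
  have hN : (0 : ℝ) < (N : ℕ) := by exact_mod_cast N.pos
  have h1 : μ N (closure (KM ((M + 1) / β)))ᶜ ≤ ENNReal.ofReal (Real.exp (-((N : ℕ) * M))) := by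
    refine (measure_mono (Set.compl_subset_compl.2 subset_closure)).trans
      ((hμ N _ (by positivity)).trans_eq ?_)
    rw [div_mul_cancel₀ _ hβ.ne', add_sub_cancel_right]
  have h2 := ENNReal.log_monotone h1
  rw [ENNReal.log_ofReal_of_pos (Real.exp_pos _), Real.log_exp] at h2
  refine (EReal.div_le_div_right_of_nonneg (by positivity) h2).trans_eq ?_
  rw [show ((N : ℕ) : EReal) = (((N : ℕ) : ℝ) : EReal) from rfl, ← EReal.coe_div]
  congr 1
  field_simp

end Tail

end MeanField

end

theorem proposition1 (lo hi : ℝ) (hlo : 0 < lo) (hhi : 0 < hi) :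
    ∃ β : ℝ, 0 < β ∧
      ∀ (E : Set (ℕ × ℕ)) (lam : ℕ → ℕ → MeanField.M1 → ℝ),
        MeanField.AssumptionA1 E → MeanField.AssumptionA2 lo hi lam →
        (∀ N : ℕ+, ∃! P : ℝ≥0 → Kernel (MeanField.M1N N) (MeanField.M1N N),
          MeanField.IsTransitionSemigroup (MeanField.generator E lam N) P) ∧
        ∃ wp : (N : ℕ+) → ProbabilityMeasure (MeanField.M1N N),
          (∀ N : ℕ+,
            MeanField.IsInvariantMeasure (MeanField.generator E lam N)
              (wp N : Measure (MeanField.M1N N)) ∧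
            ∀ μ : ProbabilityMeasure (MeanField.M1N N),
              MeanField.IsInvariantMeasure (MeanField.generator E lam N)
                (μ : Measure (MeanField.M1N N)) → μ = wp N) ∧
          MeanField.ExponentiallyTight
            (fun N : ℕ+ => (wp N : Measure (MeanField.M1N N)).map Subtype.val) ∧
          ∀ (N : ℕ+) (M : ℝ), 0 < M →
            (wp N : Measure (MeanField.M1N N)).map Subtype.val (MeanField.KM M)ᶜ
              ≤ ENNReal.ofReal (Real.exp (-((N : ℕ) * (M * β - 1)))) := by
  have he : 0 < Real.exp 1 * hi := mul_pos (Real.exp_pos 1) hhi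
  refine ⟨min 1 (lo / 2 / (Real.exp 1 * hi)), lt_min one_pos (by positivity),
    fun E lam hE h => ?_⟩
  set β := min 1 (lo / 2 / (Real.exp 1 * hi)) with hβdef
  have hβ0 : 0 < β := lt_min one_pos (by positivity)
  have hβ : β * Real.exp 1 * hi ≤ lo / 2 := by
    rw [mul_assoc]
    exact (le_div_iff₀ he).1 (min_le_right _ _)
  have hmarkov : ∀ N : ℕ+, IsMarkovKernel (MeanField.particleChain N lam lo hi) := fun N =>
    MeanField.isMarkovKernel_particleChain h hlo hhi
  have hunif := fun N : ℕ+ => MeanField.isUniformization_generator (N := N) hE h hlo hhi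
  have hrate : ∀ N : ℕ+, (2 * (N : ℕ) * hi + lo).toNNReal ≠ 0 := fun N =>
    (Real.toNNReal_pos.2 (by positivity)).ne'
  have hinv : ∀ (N : ℕ+) (μ : ProbabilityMeasure (MeanField.M1N N)),
      MeanField.IsInvariantMeasure (MeanField.generator E lam N) (μ : Measure (MeanField.M1N N))
      ↔ (μ : Measure (MeanField.M1N N)).bind (MeanField.particleChain N lam lo hi) = μ :=
    fun N μ => (hunif N).isInvariantMeasure_iff (hrate N) μ
  choose wp hwp hwp_unique using fun N : ℕ+ =>
    MeanField.existsUnique_invariant_particleChain h hlo hhi N.pos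
  have htail : ∀ (N : ℕ+) (M : ℝ), 0 < M →
      (wp N : Measure (MeanField.M1N N)).map Subtype.val (MeanField.KM M)ᶜ
        ≤ ENNReal.ofReal (Real.exp (-((N : ℕ) * (M * β - 1)))) := fun N M _ =>
    MeanField.map_compl_KM_le hβ0.le N.pos
      (MeanField.lintegral_exp_phi_le hβ0.le fun n =>
        MeanField.integral_prodFn_le_exp hE (MeanField.truncExp_nonneg hβ0.le n)
          (MeanField.truncExp_le hβ0.le n) (half_pos hlo)
          (MeanField.truncExp_drift h hhi hβ0.le (min_le_left _ _) hβ n) _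
          ((hunif N).integral_eq_zero (hwp N))) M
  exact ⟨fun N => (hunif N).existsUnique_semigroup, wp,
    fun N => ⟨(hinv N _).2 (hwp N), fun μ hμ => hwp_unique N μ ((hinv N μ).1 hμ)⟩,
    MeanField.exponentiallyTight_of_compl_KM_le hβ0 htail, htail⟩
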